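/- Let $0\le\alpha<\beta\le1$, $Q=[0,1)$, $Q_0=(\alpha,\beta)$, and let $Q_1$ be the interior of $(0,1)\setminus Q_0$. Let $\chi_0,\chi_1$ be the indicator functions of the $1$-periodic extensions of $Q_0$ and $Q_1$ to $\mathbb R$, and let $p>0$ be a $1$-periodic function on $\mathbb R$ with $p,p^{-1}\in L^\infty(0,1)$. For $\varepsilon>0$ let $A^\varepsilon$ be the operator in $L^2(\mathbb R)$ associated with the closed form $$\int_{\mathbb R}p(x/\varepsilon)\bigl(\varepsilon^2\chi_0(x/\varepsilon)+\chi_1(x/\varepsilon)\bigr)u'(x)\overline{v'(x)}\,dx,\qquad u,v\in H^1(\mathbb R).$$ For $\theta\in[0,1)$ let $H^1_\theta(Q)$ be the space of functions $v\in H^1(Q)$ of the form $v(y)=e^{2\pi i\theta y}w(y)$ with $w\in H^1(Q)$ periodic, i.e. $w(0)=w(1)$; let $$V(\theta)=\{v\in H^1_\theta(Q):\ p\,v'=0\ \text{a.e. on }Q_1\},$$ and let $A(\theta)$ be the operator, in the closure of $V(\theta)$ in $L^2(Q)$, associated with the form $\int_{Q_0}p\,u'\overline{\varphi'}\,dy$,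 $u,\varphi\in V(\theta)$. Write $\sigma(\cdot)$ for the spectrum, i.e. the set of $z\in\mathbb C$ for which the operator minus $zI$ does not have a bounded, everywhere defined inverse. **Theorem.** Let $\lambda_\varepsilon\in\sigma(A^\varepsilon)$ and $\lambda_\varepsilon\to\lambda$ as $\varepsilon\to0^+$ (for the whole family, or only along a sequence or, more generally, a filter of parameters $\varepsilon\to0^+$). Then there are $\theta\in[0,1)$ and $u\in V(\theta)\subset H^1_\theta(Q)$, $u\ne0$, such that $$\int_{\alpha}^{\beta}p(y)u'(y)\overline{\varphi'(y)}\,dy=\lambda\int_0^1u(y)\overline{\varphi(y)}\,dy\qquad\text{for all }\varphi\in V(\theta),$$ and, for the same $\theta$, $\lambda\in\sigma(A(\theta))$. -/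

import Mathlib

open MeasureTheory Set Filter Topology
open scoped ComplexConjugate ContDiff ENNReal

noncomputable section

/-- The complex Hilbert space `L²(U)`, for a subset `U` of the line. -/
abbrev L2 (U : Set ℝ) : Type := Lp ℂ 2 (volume.restrict U)

/-- `g` is the weak derivative of `u` on `U`: `∫_U u φ' = - ∫_U g φ` for all `φ ∈ C_0^∞(U)`. -/
def IsWeakDeriv (U : Set ℝ) (u g : L2 U) : Prop :=
  ∀ φ : ℝ → ℂ, ContDiff ℝ ∞ φ → HasCompactSupport φ → tsupport φ ⊆ U →
    ∫ x in U, u x * deriv φ x = -∫ x in U, g x * φ x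

lemma integrable_L2_mul {U : Set ℝ} (u : L2 U) {φ : ℝ → ℂ} (hc : Continuous φ)
    (hs : HasCompactSupport φ) : Integrable (fun x => u x * φ x) (volume.restrict U) :=
  (Lp.memLp u).integrable_mul (q := 2) (hc.memLp_of_hasCompactSupport hs)

/-- The Sobolev space `H¹(U)` of the open set `U ⊆ ℝ`. An element `u` is stored together with its
(unique) weak derivative, as the pair `(u, u')` of elements of `L²(U)`. -/
def H1 (U : Set ℝ) : Submodule ℂ (L2 U × L2 U) where
  carrier := {w | IsWeakDeriv U w.1 w.2}
  zero_mem' := by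
    intro φ _ _ _
    have h0 : ∀ ψ : ℝ → ℂ, ∫ x in U, (0 : L2 U) x * ψ x = 0 := by
      intro ψ
      refine integral_eq_zero_of_ae ?_
      filter_upwards [Lp.coeFn_zero ℂ 2 (volume.restrict U)] with x hx
      rw [hx, Pi.zero_apply, zero_mul]
    rw [Prod.fst_zero, Prod.snd_zero, h0, h0, neg_zero]
  add_mem' := by
    intro v w hv hw φ h1 h2 h3
    have key : ∀ (a b : L2 U) (ψ : ℝ → ℂ), Continuous ψ → HasCompactSupport ψ →
        ∫ x in U, (a + b) x * ψ x = (∫ x in U, a x * ψ x) + ∫ x in U, b x * ψ x := by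
      intro a b ψ hc hs
      rw [← integral_add (integrable_L2_mul a hc hs) (integrable_L2_mul b hc hs)]
      refine integral_congr_ae ?_
      filter_upwards [Lp.coeFn_add a b] with x hx
      rw [hx, Pi.add_apply, add_mul]
    have e1 := hv φ h1 h2 h3
    have e2 := hw φ h1 h2 h3
    rw [Prod.fst_add, Prod.snd_add, key _ _ _ (h1.continuous_deriv (by simp)) h2.deriv,
      key _ _ _ h1.continuous h2, e1, e2]
    ring
  smul_mem' := by
    intro c w hw φ h1 h2 h3
    have key : ∀ (a : L2 U) (ψ : ℝ → ℂ),
        ∫ x in U, (c • a) x * ψ x = c * ∫ x in U, a x * ψ x := by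
      intro a ψ
      rw [← integral_const_mul]
      refine integral_congr_ae ?_
      filter_upwards [Lp.coeFn_smul c a] with x hx
      rw [hx, Pi.smul_apply, smul_eq_mul, mul_assoc]
    have e1 := hw φ h1 h2 h3
    rw [Prod.smul_fst, Prod.smul_snd, key, key, e1]
    ring

/-- The open unit cell; it differs from `[0, 1)` by a null set. -/
abbrev cellQ : Set ℝ := Ioo 0 1

/-- The soft component `Q₀ = (α, β)` of the unit cell. -/
def cellQ0 (α β : ℝ) : Set ℝ := Ioo α β

/-- The stiff component `Q₁` of the unit cell: the interior of the complement of `Q₀` to `(0, 1)`. -/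
def cellQ1 (α β : ℝ) : Set ℝ := interior (Ioo 0 1 \ cellQ0 α β)

/-- The indicator function of the `1`-periodic extension of a subset `S` of `[0, 1)`. -/
def chiPer (S : Set ℝ) (y : ℝ) : ℝ := S.indicator 1 (Int.fract y)

/-- The coefficient `p(x/ε) (ε² χ₀(x/ε) + χ₁(x/ε))`. -/
def coeffEps (α β : ℝ) (p : ℝ → ℝ) (ε x : ℝ) : ℝ :=
  p (x / ε) * (ε ^ 2 * chiPer (cellQ0 α β) (x / ε) + chiPer (cellQ1 α β) (x / ε))

/-- The operator `A^ε` in `L²(ℝ)`, given by its graph: `(u, f)` belongs to it, i.e. `A^ε u = f`,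
if and only if `u ∈ H¹(ℝ)` and
`∫_ℝ p(x/ε) (ε² χ₀(x/ε) + χ₁(x/ε)) u' conj(v') dx = (f, v)` for all `v ∈ H¹(ℝ)`.
(Mathlib's `inner ℂ v f` is `∫ f conj(v)`.) -/
def opAeps (α β : ℝ) (p : ℝ → ℝ) (ε : ℝ) : Set (L2 univ × L2 univ) :=
  {w | ∃ du : L2 univ, (w.1, du) ∈ H1 univ ∧
    ∀ v dv : L2 univ, (v, dv) ∈ H1 univ →
      ∫ x in univ, (coeffEps α β p ε x : ℂ) * du x * conj (dv x) = inner ℂ v w.2}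

/-- `H¹_#(Q)`: the functions in `H¹(Q)` that are periodic, i.e. whose continuous representative
on `[0, 1]` takes the same value at both end points. -/
def H1per : Submodule ℂ (L2 cellQ × L2 cellQ) where
  carrier := {w | w ∈ H1 cellQ ∧ ∃ c : ℝ → ℂ, ContinuousOn c (Icc 0 1) ∧ c 0 = c 1 ∧
    ∀ᵐ y ∂(volume.restrict cellQ), w.1 y = c y}
  zero_mem' := ⟨zero_mem _, fun _ => 0, continuousOn_const, rfl, Lp.coeFn_zero ℂ 2 _⟩
  add_mem' := by
    rintro v w ⟨hv, c, hc, hc1, hc2⟩ ⟨hw, d, hd, hd1, hd2⟩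
    refine ⟨add_mem hv hw, fun y => c y + d y, hc.add hd, by simp [hc1, hd1], ?_⟩
    filter_upwards [hc2, hd2, Lp.coeFn_add v.1 w.1] with y h1 h2 h3
    rw [Prod.fst_add, h3, Pi.add_apply, h1, h2]
  smul_mem' := by
    rintro a w ⟨hw, d, hd, hd1, hd2⟩
    refine ⟨Submodule.smul_mem _ a hw, fun y => a * d y, continuousOn_const.mul hd,
      by simp [hd1], ?_⟩
    filter_upwards [hd2, Lp.coeFn_smul a w.1] with y h2 h3
    rw [Prod.smul_fst, h3, Pi.smul_apply, h2, smul_eq_mul]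

/-- `H¹_θ(Q)`: the `θ`-quasiperiodic functions `v(y) = exp(2πiθy) w(y)` in `H¹(Q)`, with
`w ∈ H¹_#(Q)`. -/
def H1theta (θ : ℝ) : Submodule ℂ (L2 cellQ × L2 cellQ) where
  carrier := {v | v ∈ H1 cellQ ∧ ∃ w ∈ H1per, ∀ᵐ y ∂(volume.restrict cellQ),
    v.1 y = Complex.exp (2 * Real.pi * Complex.I * θ * y) * w.1 y}
  zero_mem' := by
    refine ⟨zero_mem _, 0, zero_mem _, ?_⟩
    filter_upwards [Lp.coeFn_zero ℂ 2 (volume.restrict cellQ)] with y hy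
    rw [Prod.fst_zero, hy, Pi.zero_apply, mul_zero]
  add_mem' := by
    rintro v v' ⟨hv, w, hw, h⟩ ⟨hv', w', hw', h'⟩
    refine ⟨add_mem hv hv', w + w', add_mem hw hw', ?_⟩
    filter_upwards [h, h', Lp.coeFn_add v.1 v'.1, Lp.coeFn_add w.1 w'.1] with y h1 h2 h3 h4
    rw [Prod.fst_add, Prod.fst_add, h3, h4, Pi.add_apply, Pi.add_apply, h1, h2]
    ring
  smul_mem' := by
    rintro a v ⟨hv, w, hw, h⟩
    refine ⟨Submodule.smul_mem _ a hv, a • w, Submodule.smul_mem _ a hw, ?_⟩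
    filter_upwards [h, Lp.coeFn_smul a v.1, Lp.coeFn_smul a w.1] with y h1 h3 h4
    rw [Prod.smul_fst, Prod.smul_fst, h3, h4, Pi.smul_apply, Pi.smul_apply, h1, smul_eq_mul,
      smul_eq_mul]
    ring

lemma cellQ1_subset (α β : ℝ) : cellQ1 α β ⊆ cellQ :=
  interior_subset.trans sdiff_subset

/-- `V(θ)`: the functions `v ∈ H¹_θ(Q)` such that `p v' = 0` (almost everywhere) on `Q₁`. -/
def Vtheta (α β : ℝ) (p : ℝ → ℝ) (θ : ℝ) : Submodule ℂ (L2 cellQ × L2 cellQ) where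
  carrier := {v | v ∈ H1theta θ ∧ ∀ᵐ y ∂(volume.restrict (cellQ1 α β)), (p y : ℂ) * v.2 y = 0}
  zero_mem' := by
    refine ⟨zero_mem _, ?_⟩
    filter_upwards [ae_restrict_of_ae_restrict_of_subset (cellQ1_subset α β)
      (Lp.coeFn_zero ℂ 2 (volume.restrict cellQ))] with y hy
    rw [Prod.snd_zero, hy, Pi.zero_apply, mul_zero]
  add_mem' := by
    rintro v w ⟨hv, h⟩ ⟨hw, h'⟩
    refine ⟨add_mem hv hw, ?_⟩
    filter_upwards [h, h', ae_restrict_of_ae_restrict_of_subset (cellQ1_subset α β)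
      (Lp.coeFn_add v.2 w.2)] with y h1 h2 h3
    rw [Prod.snd_add, h3, Pi.add_apply, mul_add, h1, h2, add_zero]
  smul_mem' := by
    rintro a v ⟨hv, h⟩
    refine ⟨Submodule.smul_mem _ a hv, ?_⟩
    filter_upwards [h, ae_restrict_of_ae_restrict_of_subset (cellQ1_subset α β)
      (Lp.coeFn_smul a v.2)] with y h1 h3
    rw [Prod.smul_snd, h3, Pi.smul_apply, smul_eq_mul, mul_left_comm, h1, mul_zero]

/-- The Hilbert space in which `A(θ)` acts: the closure of `V(θ)` in `L²(Q)`. -/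
def Htheta (α β : ℝ) (p : ℝ → ℝ) (θ : ℝ) : Submodule ℂ (L2 cellQ) :=
  ((Vtheta α β p θ).map (LinearMap.fst ℂ (L2 cellQ) (L2 cellQ))).topologicalClosure

/-- The operator `A(θ)` in the closure of `V(θ)` in `L²(Q)`, given by its graph: `(u, f)` belongs
to it, i.e. `A(θ) u = f`, if and only if `u ∈ V(θ)` and
`∫_{Q₀} p u' conj(φ') dy = (f, φ)` for all `φ ∈ V(θ)`. -/
def opAtheta (α β : ℝ) (p : ℝ → ℝ) (θ : ℝ) :
    Set (Htheta α β p θ × Htheta α β p θ) :=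
  {w | ∃ du : L2 cellQ, ((w.1 : L2 cellQ), du) ∈ Vtheta α β p θ ∧
    ∀ φ dφ : L2 cellQ, (φ, dφ) ∈ Vtheta α β p θ →
      ∫ y in cellQ0 α β, (p y : ℂ) * du y * conj (dφ y) = inner ℂ φ (w.2 : L2 cellQ)}

/-- The spectrum of an (unbounded) operator `A` in `H`, given by its graph `G = {(u, A u)}`: the
set of `z` for which `A - z I` does not have a bounded inverse `R`, defined on all of `H`. -/
def opSpectrum {H : Type*} [NormedAddCommGroup H] [NormedSpace ℂ H] (G : Set (H × H)) : Set ℂ :=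
  {z | ¬ ∃ R : H →L[ℂ] H,
    (∀ f, (R f, f + z • R f) ∈ G) ∧ ∀ u g, (u, g) ∈ G → R (g - z • u) = u}

end

/-! Put y = x/ε, U(y) = u(εy), F(y) = f(εy), and let W = (χ₀ + ε⁻²χ₁) p U' be the rescaled flux.
Then A^ε u - z u = f becomes the first-order system U' = b W, W' = -(z U + F) on the line, with the
1-periodic coefficient b = (χ₀ + ε²χ₁)/p. In this form the limit is regular: b tends to χ₀/p
uniformly, so the monodromy operator (U, W)(0) ↦ (U, W)(1) at λ_ε converges to that of the limit
system at λ (`tendsto_monodromy`).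

The link with the spectrum is Floquet theory. The inhomogeneous system is solved on each cell, and
the pieces fit together when the initial values satisfy V (n + 1) = M (V n) + d n, where M is the
monodromy operator. If M has no eigenvalue of modulus one, this recursion is solvable in ℓ²(ℤ)
(`exists_recursion_solution`), so A^ε - z is onto. The coefficients are real, hence A^ε is symmetric
for the bilinear pairing ∫ f g, and surjectivity alone already produces a bounded inverse
(`notMem_opSpectrum_of_surjective`). Thus a point of σ(A^ε) gives a unit vector that M multiplies by
a number of modulus one, and such pairs survive the limit by compactness
(`exists_eigenvector_of_tendsto`).

An eigenvalue e^{2πiθ} of the limit monodromy gives a quasiperiodic solution of u' = χ₀ w/p, w' = -λ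
u. Here u' = 0 on Q₁ and p u' = w on Q₀. Pairing w' = -λ u with φ ∈ V(θ) and integrating by parts
gives the weak equation: the boundary terms cancel, and φ' = 0 on Q₁. Moreover u ≠ 0, since u = 0
would make w constant with w ∫_{Q₀} p⁻¹ = 0. An eigenfunction excludes a bounded inverse of A(θ) -
λ. -/

/-! ### Calculus of primitives of integrable functions. -/

/-- `u` is a primitive of the integrable function `g` on `[a, b]`. -/
structure IsPrimOn (u g : ℝ → ℂ) (a b : ℝ) : Prop where
  integrable : IntervalIntegrable g volume a b
  eq : ∀ x ∈ Icc a b, u x = u a + ∫ t in a..x, g t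

namespace IsPrimOn

variable {u g v k : ℝ → ℂ} {a b : ℝ}

lemma intervalIntegrable_sub (h : IsPrimOn u g a b) {x y : ℝ} (hx : x ∈ Icc a b)
    (hy : y ∈ Icc a b) : IntervalIntegrable g volume x y := by
  refine h.integrable.mono_set ?_
  rw [uIcc_of_le (hx.1.trans hx.2)]
  exact uIcc_subset_Icc hx hy

lemma sub_eq (h : IsPrimOn u g a b) {x y : ℝ} (hx : x ∈ Icc a b) (hy : y ∈ Icc a b) :
    u y - u x = ∫ t in x..y, g t := by
  have ha : a ∈ Icc a b := ⟨le_rfl, hx.1.trans hx.2⟩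
  rw [h.eq x hx, h.eq y hy, ← intervalIntegral.integral_add_adjacent_intervals
    (h.intervalIntegrable_sub ha hx) (h.intervalIntegrable_sub hx hy)]
  ring

lemma congr_deriv (h : IsPrimOn u g a b) (hab : a ≤ b)
    (hgk : ∀ᵐ t ∂(volume.restrict (Ioo a b)), g t = k t) : IsPrimOn u k a b := by
  rw [Measure.restrict_congr_set Ioo_ae_eq_Ioc] at hgk
  refine ⟨h.integrable.congr_ae (by rwa [uIoc_of_le hab]), fun x hx => ?_⟩
  rw [h.eq x hx]
  congr 1
  refine intervalIntegral.integral_congr_ae ?_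
  rw [uIoc_of_le hx.1]
  have := (ae_restrict_iff' measurableSet_Ioc).1 hgk
  filter_upwards [this] with t ht h1
  exact ht ⟨h1.1, h1.2.trans hx.2⟩

lemma of_integral (hg : IntervalIntegrable g volume a b) (c : ℂ) :
    IsPrimOn (fun x => c + ∫ t in a..x, g t) g a b :=
  ⟨hg, fun x _ => by simp⟩

lemma const_mul (h : IsPrimOn u g a b) (c : ℂ) :
    IsPrimOn (fun x => c * u x) (fun x => c * g x) a b := by
  refine ⟨h.integrable.const_mul c, fun x hx => ?_⟩
  simp only [h.eq x hx, intervalIntegral.integral_const_mul]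
  ring

lemma star (h : IsPrimOn u g a b) :
    IsPrimOn (fun x => conj (u x)) (fun x => conj (g x)) a b := by
  refine ⟨⟨?_, ?_⟩, fun x hx => ?_⟩
  · exact (Complex.conjCLE.toContinuousLinearMap.integrable_comp h.integrable.1)
  · exact (Complex.conjCLE.toContinuousLinearMap.integrable_comp h.integrable.2)
  · simp only [h.eq x hx, map_add]
    rw [intervalIntegral.intervalIntegral_eq_integral_uIoc,
      intervalIntegral.intervalIntegral_eq_integral_uIoc, uIoc_of_le hx.1, if_pos hx.1,
      one_smul, one_smul, integral_conj]

lemma of_hasDerivAt (hu : ∀ x, HasDerivAt u (g x) x) (hg : Continuous g) : IsPrimOn u g a b := by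
  refine ⟨hg.intervalIntegrable a b, fun x _ => ?_⟩
  rw [intervalIntegral.integral_eq_sub_of_hasDerivAt (fun x _ => hu x) (hg.intervalIntegrable a x)]
  ring

lemma ae_hasDerivAt (h : IsPrimOn u g a b) (hab : a ≤ b) :
    ∀ᵐ x, x ∈ Ioo a b → HasDerivAt u (g x) x := by
  filter_upwards [h.integrable.ae_hasDerivAt_integral] with x hx hx1
  have h1 := hx (by rw [uIcc_of_le hab]; exact Ioo_subset_Icc_self hx1) a (by simp)
  have h2 := (h1.const_add (u a))
  refine h2.congr_of_eventuallyEq ?_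
  filter_upwards [Ioo_mem_nhds hx1.1 hx1.2] with y hy
  exact h.eq y (Ioo_subset_Icc_self hy)

/-- The real and imaginary parts of the integral are absolutely continuous real primitives,
multiplied by the constants 1 and i. -/
lemma absolutelyContinuous (h : IsPrimOn u g a b) (hab : a ≤ b) :
    AbsolutelyContinuousOnInterval u a b := by
  have key : ∀ r : ℝ → ℝ, IntervalIntegrable r volume a b → ∀ c : ℂ,
      AbsolutelyContinuousOnInterval (fun x => (∫ t in a..x, r t) • c) a b := by
    intro r hr c
    have hc : AbsolutelyContinuousOnInterval (fun _ : ℝ => c) a b :=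
      (contDiffOn_const (c := c)).absolutelyContinuousOnInterval
    exact (hr.absolutelyContinuousOnInterval_intervalIntegral (by simp)).smul hc
  have hre : IntervalIntegrable (fun t => (g t).re) volume a b :=
    ⟨h.integrable.1.re, h.integrable.2.re⟩
  have him : IntervalIntegrable (fun t => (g t).im) volume a b :=
    ⟨h.integrable.1.im, h.integrable.2.im⟩
  have hc : AbsolutelyContinuousOnInterval (fun _ : ℝ => u a) a b :=
    (contDiffOn_const (c := u a)).absolutelyContinuousOnInterval
  have h1 := hc.add ((key _ hre 1).add (key _ him Complex.I))
  have heq : EqOn u ((fun _ : ℝ => u a) + ((fun x => (∫ t in a..x, (g t).re) • (1 : ℂ)) +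
      fun x => (∫ t in a..x, (g t).im) • Complex.I)) (uIcc a b) := by
    intro x hx
    rw [uIcc_of_le hab] at hx
    have ha : a ∈ Icc a b := ⟨le_rfl, hab⟩
    have hi := h.intervalIntegrable_sub ha hx
    simp only [Pi.add_apply, h.eq x hx, Complex.real_smul, mul_one]
    rw [← intervalIntegral.integral_ofReal, ← intervalIntegral.integral_ofReal,
      ← intervalIntegral.integral_mul_const, ← intervalIntegral.integral_add]
    · simp only [Complex.re_add_im]
    · exact ⟨hi.1.re.ofReal, hi.2.re.ofReal⟩
    · exact IntervalIntegrable.mul_const ⟨hi.1.im.ofReal, hi.2.im.ofReal⟩ _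
  unfold AbsolutelyContinuousOnInterval at h1 ⊢
  refine h1.congr' ?_
  rw [EventuallyEq, eventually_inf_principal]
  refine Eventually.of_forall fun E hE => Finset.sum_congr rfl fun i hi => ?_
  rw [heq (hE.1 i hi).1, heq (hE.1 i hi).2]

lemma continuousOn (h : IsPrimOn u g a b) (hab : a ≤ b) : ContinuousOn u (Icc a b) := by
  have := (h.absolutelyContinuous hab).continuousOn
  rwa [uIcc_of_le hab] at this

lemma mul (h : IsPrimOn u g a b) (h' : IsPrimOn v k a b) (hab : a ≤ b) :
    IsPrimOn (fun x => u x * v x) (fun x => g x * v x + u x * k x) a b := by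
  have cu := h.continuousOn hab
  have cv := h'.continuousOn hab
  have hi : IntervalIntegrable (fun x => g x * v x + u x * k x) volume a b :=
    (h.integrable.mul_continuousOn (by rwa [uIcc_of_le hab])).add
      (h'.integrable.continuousOn_mul (by rwa [uIcc_of_le hab]))
  refine ⟨hi, ?_⟩
  have hP := of_integral hi (0 : ℂ)
  -- The product minus the primitive of the expected derivative is absolutely continuous with
  -- derivative zero almost everywhere, hence constant.
  have hac := (((h.absolutelyContinuous hab).smul (h'.absolutelyContinuous hab)).sub
    (hP.absolutelyContinuous hab))
  obtain ⟨C, hC⟩ := hac.const_of_ae_hasDerivAt_zero (by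
    have hb : ∀ᵐ x : ℝ, x ≠ a ∧ x ≠ b := by
      filter_upwards [compl_mem_ae_iff.2 (measure_singleton a),
        compl_mem_ae_iff.2 (measure_singleton b)] with x h1 h2
      exact ⟨h1, h2⟩
    filter_upwards [h.ae_hasDerivAt hab, h'.ae_hasDerivAt hab, hP.ae_hasDerivAt hab, hb]
      with x h1 h2 h3 h4 h5
    rw [uIcc_of_le hab] at h5
    have h6 : x ∈ Ioo a b := ⟨lt_of_le_of_ne h5.1 h4.1.symm, lt_of_le_of_ne h5.2 h4.2⟩
    have := ((h1 h6).mul (h2 h6)).sub (h3 h6)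
    rwa [sub_self] at this)
  intro x hx
  have e1 := hC x (by rwa [uIcc_of_le hab])
  have e2 := hC a (by simp)
  simp only [Pi.sub_apply, smul_eq_mul, Pi.mul_apply, zero_add,
    intervalIntegral.integral_same] at e1 e2
  linear_combination e1 - e2

end IsPrimOn

/-! ### Weak derivatives in one dimension and integration by parts. -/

lemma IsPrimOn.setIntegral_mul_deriv {u g : ℝ → ℂ} {a b : ℝ} (h : IsPrimOn u g a b) (hab : a ≤ b)
    {φ : ℝ → ℂ} (hφ : ContDiff ℝ ∞ φ) (ha : φ a = 0) (hb : φ b = 0) :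
    ∫ x in Ioo a b, u x * deriv φ x = -∫ x in Ioo a b, g x * φ x := by
  have hd : Continuous (deriv φ) := hφ.continuous_deriv (by simp)
  have hP : IsPrimOn φ (deriv φ) a b :=
    IsPrimOn.of_hasDerivAt (fun x => (hφ.differentiable (by simp) x).hasDerivAt) hd
  have h1 := (h.mul hP hab).sub_eq (left_mem_Icc.2 hab) (right_mem_Icc.2 hab)
  rw [ha, hb, mul_zero, mul_zero, sub_zero, intervalIntegral.integral_add
    (h.integrable.mul_continuousOn hφ.continuous.continuousOn)
    (hd.intervalIntegrable a b |>.continuousOn_mul (by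
      rw [uIcc_of_le hab]; exact h.continuousOn hab)),
    intervalIntegral.integral_of_le hab, intervalIntegral.integral_of_le hab,
    integral_Ioc_eq_integral_Ioo, integral_Ioc_eq_integral_Ioo] at h1
  linear_combination -h1

lemma HasCompactSupport.exists_tsupport_subset_Ioo {φ : ℝ → ℂ} (hs : HasCompactSupport φ) :
    ∃ R : ℝ, 0 < R ∧ tsupport φ ⊆ Ioo (-R) R := by
  obtain ⟨R, hR⟩ := hs.isCompact.isBounded.subset_ball (0 : ℝ)
  refine ⟨max R 1, by positivity, fun x hx => ?_⟩
  have := hR hx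
  rw [Metric.mem_ball, Real.dist_eq, sub_zero, abs_lt] at this
  exact ⟨by linarith [le_max_left R 1], by linarith [le_max_left R 1]⟩

lemma integral_mul_deriv_of_isPrimOn {u g : ℝ → ℂ} (h : ∀ a b, a ≤ b → IsPrimOn u g a b)
    {φ : ℝ → ℂ} (hφ : ContDiff ℝ ∞ φ) (hs : HasCompactSupport φ) :
    ∫ x, u x * deriv φ x = -∫ x, g x * φ x := by
  obtain ⟨R, hR, hsub⟩ := hs.exists_tsupport_subset_Ioo
  have hz : ∀ x, x ∉ Ioo (-R) R → φ x = 0 := fun x hx =>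
    image_eq_zero_of_notMem_tsupport fun h => hx (hsub h)
  have hz' : ∀ x, x ∉ Ioo (-R) R → deriv φ x = 0 := fun x hx =>
    image_eq_zero_of_notMem_tsupport fun h => hx (hsub (tsupport_deriv_subset h))
  have h1 := (h (-R) R (by linarith)).setIntegral_mul_deriv (by linarith) hφ (hz _ (by simp))
    (hz _ (by simp))
  rwa [setIntegral_eq_integral_of_forall_compl_eq_zero (fun x hx => by rw [hz' x hx, mul_zero]),
    setIntegral_eq_integral_of_forall_compl_eq_zero (fun x hx => by rw [hz x hx, mul_zero])] at h1

/-- The du Bois-Reymond lemma on an open interval. -/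
lemma exists_ae_eq_const_of_integral_mul_deriv_eq_zero {U : Set ℝ} (hU : IsOpen U)
    (hc : U.OrdConnected) {x₀ : ℝ} (hx₀ : x₀ ∈ U) {h : ℝ → ℂ} (hh : LocallyIntegrable h)
    (hz : ∀ φ : ℝ → ℂ, ContDiff ℝ ∞ φ → HasCompactSupport φ → tsupport φ ⊆ U →
      ∫ x, h x * deriv φ x = 0) :
    ∃ c, ∀ᵐ x, x ∈ U → h x = c := by
  obtain ⟨r, hr, hrU⟩ := Metric.isOpen_iff.1 hU x₀ hx₀
  let B : ContDiffBump x₀ := ⟨r / 4, r / 2, by linarith, by linarith⟩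
  set ρ : ℝ → ℝ := B.normed volume with hρ
  have hρd : ContDiff ℝ ∞ ρ := B.contDiff_normed
  have hρs : tsupport ρ ⊆ U := by
    rw [hρ, B.tsupport_normed_eq]
    exact (Metric.closedBall_subset_ball (by change r / 2 < r; linarith)).trans hrU
  have hρc : HasCompactSupport ρ := B.hasCompactSupport_normed
  have hint : ∀ ψ : ℝ → ℝ, Continuous ψ → HasCompactSupport ψ →
      Integrable (fun x => ψ x • h x) := fun ψ h1 h2 =>
    hh.integrable_smul_left_of_hasCompactSupport h1 h2
  set c : ℂ := ∫ x, ρ x • h x with hcdef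
  refine ⟨c, ?_⟩
  have main := hU.ae_eq_zero_of_integral_contDiff_smul_eq_zero (μ := volume)
    (f := fun x => h x - c) ((hh.sub (locallyIntegrable_const c)).locallyIntegrableOn U) ?_
  · filter_upwards [main] with x hx h1
    exact sub_eq_zero.1 (hx h1)
  intro φ hφ hφc hφU
  set m : ℝ := ∫ x, φ x with hm
  -- Removing `m * ρ` makes the mean zero, so the primitive of `f` vanishes on both sides of the
  -- supports and is itself a test function. Testing `h` with it shows that `h` has the same pairing
  -- with `φ` as the constant `c`.
  set f : ℝ → ℝ := fun x => φ x - m * ρ x with hf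
  have hfd : ContDiff ℝ ∞ f := hφ.sub (contDiff_const.mul hρd)
  have hf0 : ∫ x, f x = 0 := by
    rw [hf, integral_sub (hφ.continuous.integrable_of_hasCompactSupport hφc)
      ((hρd.continuous.integrable_of_hasCompactSupport hρc).const_mul _), integral_const_mul,
      B.integral_normed, mul_one, sub_self]
  have hK : IsCompact (tsupport φ ∪ tsupport ρ) := hφc.isCompact.union hρc.isCompact
  have hne : (tsupport φ ∪ tsupport ρ).Nonempty := by
    refine ⟨x₀, Or.inr ?_⟩
    rw [hρ, B.tsupport_normed_eq]
    exact Metric.mem_closedBall_self (by change 0 ≤ r / 2; linarith)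
  -- The primitive can be nonzero between the two supports, so its support is controlled only by
  -- their hull `[a, b]`; this lies in `U` because `U` is order-connected.
  obtain ⟨a, ha⟩ := hK.exists_isLeast hne
  obtain ⟨b, hb⟩ := hK.exists_isGreatest hne
  have hKU : tsupport φ ∪ tsupport ρ ⊆ U := union_subset hφU hρs
  have habU : Icc a b ⊆ U := hc.out (hKU ha.1) (hKU hb.1)
  have hfz : ∀ x, x ∉ Icc a b → f x = 0 := by
    intro x hx
    have h1 : x ∉ tsupport φ ∪ tsupport ρ := fun hmem => hx ⟨ha.2 hmem, hb.2 hmem⟩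
    rw [mem_union, not_or] at h1
    simp only [hf, image_eq_zero_of_notMem_tsupport h1.1, image_eq_zero_of_notMem_tsupport h1.2,
      mul_zero, sub_zero]
  have hfi : Integrable f := (hφ.continuous.integrable_of_hasCompactSupport hφc).sub
      ((hρd.continuous.integrable_of_hasCompactSupport hρc).const_mul _)
  set ψ : ℝ → ℝ := fun x => ∫ t in a..x, f t with hψ
  have hψd : ∀ x, HasDerivAt ψ (f x) x := fun x =>
    intervalIntegral.integral_hasDerivAt_right (hfd.continuous.intervalIntegrable _ _)
      (hfd.continuous.stronglyMeasurableAtFilter _ _) hfd.continuous.continuousAt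
  have hψz : ∀ x, x ∉ Icc a b → ψ x = 0 := by
    intro x hx
    have hab : ∫ t in a..b, f t = 0 := by
      rw [intervalIntegral.integral_of_le (hb.2 ha.1), ← integral_Icc_eq_integral_Ioc,
        setIntegral_eq_integral_of_forall_compl_eq_zero hfz, hf0]
    rcases lt_or_ge x a with h1 | h1
    · simp only [hψ]
      rw [intervalIntegral.integral_symm, intervalIntegral.integral_of_le h1.le,
        integral_Ioc_eq_integral_Ioo, setIntegral_eq_zero_of_forall_eq_zero, neg_zero]
      exact fun t ht => hfz t fun h2 => absurd h2.1 (not_le.2 ht.2)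
    · have h2 : b < x := by
        by_contra h3
        exact hx ⟨h1, not_lt.1 h3⟩
      simp only [hψ]
      rw [← intervalIntegral.integral_add_adjacent_intervals
        (hfd.continuous.intervalIntegrable a b) (hfd.continuous.intervalIntegrable b x), hab,
        intervalIntegral.integral_of_le h2.le, setIntegral_eq_zero_of_forall_eq_zero, add_zero]
      exact fun t ht => hfz t fun h3 => absurd h3.2 (not_le.2 ht.1)
  have hderiv : deriv ψ = f := funext fun x => (hψd x).deriv
  have hψsm : ContDiff ℝ ∞ ψ := by
    rw [contDiff_infty_iff_deriv, hderiv]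
    exact ⟨fun x => (hψd x).differentiableAt, hfd⟩
  have hψC : ContDiff ℝ ∞ (fun x => (ψ x : ℂ)) := Complex.ofRealCLM.contDiff.comp hψsm
  have hts : tsupport (fun x => (ψ x : ℂ)) ⊆ Icc a b := by
    refine closure_minimal (fun x hx => ?_) isClosed_Icc
    by_contra h1
    exact hx (by simp [hψz x h1])
  have hcs : HasCompactSupport (fun x => (ψ x : ℂ)) :=
    isCompact_Icc.of_isClosed_subset (isClosed_tsupport _) hts
  have h0 := hz _ hψC hcs (hts.trans habU)
  have hdC : ∀ x, deriv (fun x => (ψ x : ℂ)) x = (f x : ℂ) := fun x =>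
    ((hψd x).ofReal_comp).deriv
  have h2 : ∫ x, h x * deriv (fun x => (ψ x : ℂ)) x = (∫ x, φ x • h x) - m * c := by
    rw [hcdef, ← integral_const_mul, ← integral_sub (hint φ hφ.continuous hφc)
      ((hint ρ hρd.continuous hρc).const_mul _)]
    refine integral_congr_ae (Eventually.of_forall fun x => ?_)
    simp only [hdC, hf, Complex.real_smul]
    push_cast
    ring
  rw [h2] at h0
  simp only [smul_sub]
  rw [integral_sub (hint φ hφ.continuous hφc)
    ((hφ.continuous.integrable_of_hasCompactSupport hφc).smul_const c), integral_smul_const,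
    ← hm, Complex.real_smul]
  exact h0

lemma MeasureTheory.MemLp.locallyIntegrable_two {g : ℝ → ℂ} (hg : MemLp g 2) :
    LocallyIntegrable g :=
  hg.locallyIntegrable (by norm_num)

lemma MeasureTheory.LocallyIntegrable.intervalIntegrable_volume {g : ℝ → ℂ}
    (hg : LocallyIntegrable g) (a b : ℝ) : IntervalIntegrable g volume a b :=
  (hg.integrableOn_isCompact isCompact_uIcc).intervalIntegrable

lemma isPrimOn_of_locallyIntegrable {g : ℝ → ℂ} (hg : LocallyIntegrable g) (c : ℂ) (x₀ a b : ℝ) :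
    IsPrimOn (fun x => c + ∫ t in x₀..x, g t) g a b := by
  refine ⟨hg.intervalIntegrable_volume a b, fun x _ => ?_⟩
  rw [add_assoc, intervalIntegral.integral_add_adjacent_intervals
    (hg.intervalIntegrable_volume _ _) (hg.intervalIntegrable_volume _ _)]

/-- An `H¹` function on an open interval has a continuous representative, which is a primitive of
its weak derivative. -/
lemma exists_isPrimOn_of_isWeakDeriv {U : Set ℝ} (hU : IsOpen U) (hc : U.OrdConnected) {x₀ : ℝ}
    (hx₀ : x₀ ∈ U) {u g : L2 U} (h : IsWeakDeriv U u g) :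
    ∃ v : ℝ → ℂ, (∀ᵐ x ∂(volume.restrict U), u x = v x) ∧
      ∀ a b, IsPrimOn v (U.indicator g) a b := by
  have hmu : MemLp (U.indicator u) 2 :=
    (memLp_indicator_iff_restrict hU.measurableSet).2 (Lp.memLp u)
  have hmg : MemLp (U.indicator g) 2 :=
    (memLp_indicator_iff_restrict hU.measurableSet).2 (Lp.memLp g)
  have hP := isPrimOn_of_locallyIntegrable hmg.locallyIntegrable_two 0 x₀
  set P : ℝ → ℂ := fun x => 0 + ∫ t in x₀..x, U.indicator g t with hPdef
  have hPc : Continuous P :=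
    continuous_const.add (intervalIntegral.continuous_primitive
      (fun a b => hmg.locallyIntegrable_two.intervalIntegrable_volume a b) x₀)
  -- `u` and `P` have the same weak derivative on `U`, so they differ by a constant there.
  obtain ⟨c, hc⟩ := exists_ae_eq_const_of_integral_mul_deriv_eq_zero hU hc hx₀
    (h := fun x => U.indicator u x - P x)
    (hmu.locallyIntegrable_two.sub hPc.locallyIntegrable) (by
    intro φ h1 h2 h3
    have e1 := integral_mul_deriv_of_isPrimOn (fun a b _ => hP a b) h1 h2
    have e2 := h φ h1 h2 h3
    have hd : Continuous (deriv φ) := h1.continuous_deriv (by simp)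
    simp only [sub_mul]
    rw [integral_sub, e1]
    · rw [← integral_indicator hU.measurableSet, ← integral_indicator hU.measurableSet] at e2
      have e3 : ∀ x, U.indicator u x * deriv φ x = U.indicator (fun x => u x * deriv φ x) x := by
        intro x
        by_cases hx : x ∈ U <;> simp [hx]
      have e4 : ∀ x, U.indicator g x * φ x = U.indicator (fun x => g x * φ x) x := by
        intro x
        by_cases hx : x ∈ U <;> simp [hx]
      simp only [e3, e4, e2, sub_neg_eq_add, neg_add_cancel]
    · simpa only [smul_eq_mul] using
        hmu.locallyIntegrable_two.integrable_smul_right_of_hasCompactSupport hd h2.deriv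
    · exact (hPc.mul hd).integrable_of_hasCompactSupport h2.deriv.mul_left)
  refine ⟨fun x => c + ∫ t in x₀..x, U.indicator g t, ?_,
    isPrimOn_of_locallyIntegrable hmg.locallyIntegrable_two c x₀⟩
  rw [ae_restrict_iff' hU.measurableSet]
  filter_upwards [hc] with x hx hxU
  have := hx hxU
  rw [indicator_of_mem hxU] at this
  rw [← this, hPdef]
  ring

lemma isWeakDeriv_cellQ {u g : L2 cellQ} {v k : ℝ → ℂ} (h : IsPrimOn v k 0 1)
    (hu : ∀ᵐ x ∂(volume.restrict cellQ), u x = v x)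
    (hg : ∀ᵐ x ∂(volume.restrict cellQ), g x = k x) : IsWeakDeriv cellQ u g := by
  intro φ h1 _ h3
  have hz : ∀ x, x ∉ Ioo (0 : ℝ) 1 → φ x = 0 := fun x hx =>
    image_eq_zero_of_notMem_tsupport fun h => hx (h3 h)
  have e := h.setIntegral_mul_deriv zero_le_one h1 (hz _ (by simp)) (hz _ (by simp))
  rw [integral_congr_ae (g := fun x => v x * deriv φ x), e, integral_congr_ae]
  · filter_upwards [hg] with x hx
    rw [hx]
  · filter_upwards [hu] with x hx
    rw [hx]

lemma isWeakDeriv_univ {u g : L2 univ} {v k : ℝ → ℂ} (h : ∀ a b, a ≤ b → IsPrimOn v k a b)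
    (hu : ∀ᵐ x ∂(volume.restrict univ), u x = v x)
    (hg : ∀ᵐ x ∂(volume.restrict univ), g x = k x) : IsWeakDeriv univ u g := by
  intro φ h1 h2 _
  rw [integral_congr_ae (g := fun x => v x * deriv φ x), setIntegral_univ,
    integral_mul_deriv_of_isPrimOn h h1 h2, ← setIntegral_univ, integral_congr_ae]
  · filter_upwards [hg] with x hx
    rw [hx]
  · filter_upwards [hu] with x hx
    rw [hx]

/-- Integration by parts on the line, for functions which are in `L²` with their derivatives. -/
lemma integral_mul_add_mul_eq_zero {u g v k : ℝ → ℂ} (hu : ∀ a b, a ≤ b → IsPrimOn u g a b)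
    (hv : ∀ a b, a ≤ b → IsPrimOn v k a b) (mu : MemLp u 2) (mg : MemLp g 2) (mv : MemLp v 2)
    (mk : MemLp k 2) : ∫ x, (g x * v x + u x * k x) = 0 := by
  have hi : Integrable (fun x => g x * v x + u x * k x) :=
    (mg.integrable_mul mv).add (mu.integrable_mul mk)
  have hi0 : Integrable (fun x => u x * v x) := mu.integrable_mul mv
  have hp : ∀ a b, a ≤ b → IsPrimOn (fun x => u x * v x) (fun x => g x * v x + u x * k x) a b :=
    fun a b hab => (hu a b hab).mul (hv a b hab) hab
  have htop : Tendsto (fun x : ℝ => u x * v x) atTop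
      (𝓝 (u 0 * v 0 + ∫ x in Ioi 0, (g x * v x + u x * k x))) := by
    have h1 := intervalIntegral_tendsto_integral_Ioi (0 : ℝ) hi.integrableOn tendsto_id
    refine (h1.const_add (u 0 * v 0)).congr' ?_
    filter_upwards [eventually_ge_atTop 0] with x hx
    exact ((hp 0 x hx).eq x ⟨hx, le_rfl⟩).symm
  have hbot : Tendsto (fun x : ℝ => u x * v x) atBot
      (𝓝 (u 0 * v 0 - ∫ x in Iic 0, (g x * v x + u x * k x))) := by
    have h1 := intervalIntegral_tendsto_integral_Iic (0 : ℝ) hi.integrableOn tendsto_id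
    refine (h1.const_sub (u 0 * v 0)).congr' ?_
    filter_upwards [eventually_le_atBot 0] with x hx
    have := (hp x 0 hx).eq 0 ⟨hx, le_rfl⟩
    simp only [id]
    rw [this]
    ring
  -- The product `u v` is integrable and has limits at both ends; as half-lines have infinite
  -- measure, both limits must be zero.
  have e1 := (hi0.integrableAtFilter atTop).eq_zero_of_tendsto (fun s hs => by
    obtain ⟨a, ha⟩ := mem_atTop_sets.1 hs
    exact top_le_iff.1 (Real.volume_Ici (a := a) ▸ measure_mono (fun x hx => ha x hx))) htop
  have e2 := (hi0.integrableAtFilter atBot).eq_zero_of_tendsto (fun s hs => by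
    obtain ⟨a, ha⟩ := mem_atBot_sets.1 hs
    exact top_le_iff.1 (Real.volume_Iic (a := a) ▸ measure_mono (fun x hx => ha x hx))) hbot
  rw [← intervalIntegral.integral_Iic_add_Ioi (b := 0) hi.integrableOn hi.integrableOn]
  linear_combination e1 - e2

/-! ### The first-order system on a cell: Volterra operators and monodromy. -/

/-- `b` is measurable on `(0, 1)`, and bounded there by `K` almost everywhere. -/
structure IsBddCoeff (b : ℝ → ℂ) (K : ℝ) : Prop where
  nonneg : 0 ≤ K
  meas : AEStronglyMeasurable b (volume.restrict (Ioo 0 1))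
  bound : ∀ᵐ t ∂(volume.restrict (Ioo 0 1)), ‖b t‖ ≤ K

namespace IsBddCoeff

variable {b : ℝ → ℂ} {K : ℝ}

lemma one : IsBddCoeff (fun _ => 1) 1 :=
  ⟨zero_le_one, aestronglyMeasurable_const, Eventually.of_forall fun _ => by simp⟩

lemma intervalIntegrable_mul (h : IsBddCoeff b K) {f : ℝ → ℂ} (hf : Continuous f) {x : ℝ}
    (hx : x ∈ Icc (0 : ℝ) 1) : IntervalIntegrable (fun t => b t * f t) volume 0 x := by
  have h1 : IntegrableOn (fun t => b t * f t) (Ioo 0 1) :=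
    ((hf.integrableOn_Icc (a := 0) (b := 1)).mono_set Ioo_subset_Icc_self).bdd_mul h.meas h.bound
  rw [intervalIntegrable_iff_integrableOn_Ioo_of_le hx.1]
  exact h1.mono_set (Ioo_subset_Ioo_right hx.2)

end IsBddCoeff

/-- The Banach space of continuous functions on the unit interval. -/
abbrev CI : Type := BoundedContinuousFunction unitInterval ℂ

/-- The extension of a function on the unit interval which is constant outside of it. -/
noncomputable def CI.ext (u : CI) (t : ℝ) : ℂ := u (projIcc 0 1 zero_le_one t)

lemma CI.continuous_ext (u : CI) : Continuous u.ext := u.continuous.comp continuous_projIcc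

lemma CI.norm_ext_le (u : CI) (t : ℝ) : ‖u.ext t‖ ≤ ‖u‖ := u.norm_coe_le_norm _

lemma CI.ext_of_mem (u : CI) {t : ℝ} (ht : t ∈ Icc (0 : ℝ) 1) : u.ext t = u ⟨t, ht⟩ := by
  rw [CI.ext, projIcc_of_mem]

/-- The Volterra integral `e^{-κx} ∫₀ˣ e^{κt} b(t) u(t) dt`. -/
noncomputable def volterraFun (κ : ℝ) (b : ℝ → ℂ) (u : CI) (x : ℝ) : ℂ :=
  Complex.exp (-κ * x) * ∫ t in (0 : ℝ)..x, b t * (Complex.exp (κ * t) * u.ext t)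

lemma continuous_exp_mul_ext (κ : ℝ) (u : CI) :
    Continuous fun t : ℝ => Complex.exp (κ * t) * u.ext t :=
  (by fun_prop : Continuous fun t : ℝ => Complex.exp (κ * t)).mul u.continuous_ext

/-- The kernel e^{-κ(x - t)} has integral at most 1/κ over [0, x]. This gain makes the integral
operator a contraction for large κ, so that a Neumann series solves the system on the entire cell at
once. -/
lemma norm_volterraFun_le {κ : ℝ} (hκ : 0 < κ) {b : ℝ → ℂ} {K : ℝ} (h : IsBddCoeff b K) (u : CI)
    {x : ℝ} (hx : x ∈ Icc (0 : ℝ) 1) : ‖volterraFun κ b u x‖ ≤ K / κ * ‖u‖ := by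
  have h1 : ‖∫ t in (0 : ℝ)..x, b t * (Complex.exp (κ * t) * u.ext t)‖ ≤
      ∫ t in (0 : ℝ)..x, K * ‖u‖ * Real.exp (κ * t) := by
    refine intervalIntegral.norm_integral_le_of_norm_le hx.1 ?_
      ((by fun_prop : Continuous fun t : ℝ => K * ‖u‖ * Real.exp (κ * t)).intervalIntegrable _ _)
    have h2 := h.bound
    rw [Measure.restrict_congr_set Ioo_ae_eq_Ioc, ae_restrict_iff' measurableSet_Ioc] at h2
    filter_upwards [h2] with t ht hm
    have h3 := ht ⟨hm.1, hm.2.trans hx.2⟩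
    rw [norm_mul, norm_mul, Complex.norm_exp]
    have : ((κ : ℂ) * t).re = κ * t := by simp
    rw [this]
    calc ‖b t‖ * (Real.exp (κ * t) * ‖u.ext t‖) ≤ K * (Real.exp (κ * t) * ‖u‖) := by
          gcongr
          · exact h.nonneg
          · exact u.norm_ext_le t
      _ = _ := by ring
  have h2 : ∫ t in (0 : ℝ)..x, K * ‖u‖ * Real.exp (κ * t) =
      K * ‖u‖ * ((Real.exp (κ * x) - 1) / κ) := by
    rw [intervalIntegral.integral_const_mul]
    congr 1
    have hd : ∀ t : ℝ, HasDerivAt (fun t => Real.exp (κ * t) / κ) (Real.exp (κ * t)) t := by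
      intro t
      have := (((hasDerivAt_id t).const_mul κ).exp).div_const κ
      simpa [hκ.ne'] using this
    rw [intervalIntegral.integral_eq_sub_of_hasDerivAt (fun t _ => hd t)
      ((by fun_prop : Continuous fun t : ℝ => Real.exp (κ * t)).intervalIntegrable _ _)]
    simp
    ring
  rw [volterraFun, norm_mul, Complex.norm_exp]
  have : (-(κ : ℂ) * x).re = -(κ * x) := by simp
  rw [this]
  calc Real.exp (-(κ * x)) * _ ≤ Real.exp (-(κ * x)) *
        (K * ‖u‖ * ((Real.exp (κ * x) - 1) / κ)) := by
        rw [← h2]; gcongr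
    _ = K / κ * ‖u‖ * (1 - Real.exp (-(κ * x))) := by
        rw [Real.exp_neg]
        field_simp
    _ ≤ K / κ * ‖u‖ * 1 := by
        have := h.nonneg
        gcongr
        linarith [Real.exp_pos (-(κ * x))]
    _ = _ := mul_one _

lemma continuousOn_volterraFun (κ : ℝ) {b : ℝ → ℂ} {K : ℝ} (h : IsBddCoeff b K) (u : CI) :
    ContinuousOn (volterraFun κ b u) (Icc 0 1) := by
  have h1 := IsPrimOn.of_integral (h.intervalIntegrable_mul (continuous_exp_mul_ext κ u)
    (right_mem_Icc.2 zero_le_one)) 0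
  have h2 := h1.continuousOn zero_le_one
  simp only [zero_add] at h2
  exact (by fun_prop : Continuous fun x : ℝ => Complex.exp (-κ * x)).continuousOn.mul h2

/-- The Volterra operator with the coefficient `b`, conjugated with `e^{κx}`. -/
noncomputable def volterra {κ : ℝ} (hκ : 0 < κ) {b : ℝ → ℂ} {K : ℝ} (h : IsBddCoeff b K) : CI →L[ℂ] CI :=
  LinearMap.mkContinuous
    { toFun := fun u => BoundedContinuousFunction.mkOfCompact ⟨fun x => volterraFun κ b u x,
        (continuousOn_volterraFun κ h u).comp_continuous continuous_subtype_val fun x => x.2⟩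
      map_add' := by
        intro u v
        refine BoundedContinuousFunction.ext fun x => ?_
        change volterraFun κ b (u + v) x = volterraFun κ b u x + volterraFun κ b v x
        simp only [volterraFun]
        rw [← mul_add, ← intervalIntegral.integral_add
          (h.intervalIntegrable_mul (continuous_exp_mul_ext κ u) x.2)
          (h.intervalIntegrable_mul (continuous_exp_mul_ext κ v) x.2)]
        congr 2
        funext t
        simp only [CI.ext, BoundedContinuousFunction.add_apply]
        ring
      map_smul' := by
        intro c u
        refine BoundedContinuousFunction.ext fun x => ?_
        change volterraFun κ b (c • u) x = c • volterraFun κ b u x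
        simp only [volterraFun, smul_eq_mul]
        rw [mul_left_comm, ← intervalIntegral.integral_const_mul c]
        congr 2
        funext t
        simp only [CI.ext, BoundedContinuousFunction.smul_apply, smul_eq_mul]
        ring }
    (K / κ) (fun u => (BoundedContinuousFunction.norm_le (by have := h.nonneg; positivity)).2
      fun x => norm_volterraFun_le hκ h u x.2)

lemma volterra_apply {κ : ℝ} (hκ : 0 < κ) {b : ℝ → ℂ} {K : ℝ} (h : IsBddCoeff b K) (u : CI)
    (x : unitInterval) : volterra hκ h u x = volterraFun κ b u x := rfl

lemma norm_volterra_le {κ : ℝ} (hκ : 0 < κ) {b : ℝ → ℂ} {K : ℝ} (h : IsBddCoeff b K) :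
    ‖volterra hκ h‖ ≤ K / κ :=
  LinearMap.mkContinuous_norm_le _ (by have := h.nonneg; positivity) _

/-- The operator is linear in its coefficient, so uniform convergence of coefficients implies
convergence in operator norm. -/
lemma norm_volterra_sub_le {κ : ℝ} (hκ : 0 < κ) {b b' : ℝ → ℂ} {K K' δ : ℝ} (h : IsBddCoeff b K)
    (h' : IsBddCoeff b' K') (hδ : IsBddCoeff (fun t => b t - b' t) δ) :
    ‖volterra hκ h - volterra hκ h'‖ ≤ δ / κ := by
  have : volterra hκ h - volterra hκ h' = volterra hκ hδ := by
    refine ContinuousLinearMap.ext fun u => BoundedContinuousFunction.ext fun x => ?_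
    change volterraFun κ b u x - volterraFun κ b' u x = volterraFun κ _ u x
    simp only [volterraFun]
    rw [← mul_sub, ← intervalIntegral.integral_sub
      (h.intervalIntegrable_mul (continuous_exp_mul_ext κ u) x.2)
      (h'.intervalIntegrable_mul (continuous_exp_mul_ext κ u) x.2)]
    simp only [sub_mul]
  rw [this]
  exact norm_volterra_le hκ hδ

/-- The integral operator of the system `u' = b w`, `w' = -z u`. -/
noncomputable def systemOp {κ : ℝ} (hκ : 0 < κ) {b : ℝ → ℂ} {K : ℝ} (h : IsBddCoeff b K) (z : ℂ) :
    CI × CI →L[ℂ] CI × CI :=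
  (ContinuousLinearMap.inl ℂ CI CI).comp
      ((volterra hκ h).comp (ContinuousLinearMap.snd ℂ CI CI)) -
    z • (ContinuousLinearMap.inr ℂ CI CI).comp
      ((volterra hκ IsBddCoeff.one).comp (ContinuousLinearMap.fst ℂ CI CI))

lemma systemOp_apply {κ : ℝ} (hκ : 0 < κ) {b : ℝ → ℂ} {K : ℝ} (h : IsBddCoeff b K) (z : ℂ)
    (Y : CI × CI) : systemOp hκ h z Y =
      (volterra hκ h Y.2, -(z • volterra hκ IsBddCoeff.one Y.1)) := by
  simp [systemOp]

/-- Each component of the result involves only one component of the argument, so in the maximum norm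
the bounds `K / κ` and `‖z‖ / κ` do not add up. -/
lemma norm_systemOp_lt_one {κ : ℝ} (hκ : 0 < κ) {b : ℝ → ℂ} {K : ℝ} (h : IsBddCoeff b K) {z : ℂ}
    (hK : K < κ) (hz : ‖z‖ < κ) : ‖systemOp hκ h z‖ < 1 := by
  have h0 := h.nonneg
  have hm : max K ‖z‖ / κ < 1 := by
    rw [div_lt_one hκ]
    exact max_lt hK hz
  refine lt_of_le_of_lt (ContinuousLinearMap.opNorm_le_bound _ (by positivity) fun Y => ?_) hm
  rw [systemOp_apply, Prod.norm_def]
  refine max_le ?_ ?_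
  · calc ‖volterra hκ h Y.2‖ ≤ K / κ * ‖Y.2‖ :=
          (volterra hκ h).le_of_opNorm_le (norm_volterra_le hκ h) _
      _ ≤ max K ‖z‖ / κ * ‖Y‖ := by
          gcongr
          · exact le_max_left _ _
          · exact norm_snd_le Y
  · simp only [norm_neg, norm_smul]
    calc ‖z‖ * ‖volterra hκ IsBddCoeff.one Y.1‖ ≤ ‖z‖ * (1 / κ * ‖Y.1‖) := by
          gcongr
          exact (volterra hκ _).le_of_opNorm_le (norm_volterra_le hκ _) _
      _ = ‖z‖ / κ * ‖Y.1‖ := by ring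
      _ ≤ max K ‖z‖ / κ * ‖Y‖ := by
          gcongr
          · exact le_max_right _ _
          · exact norm_fst_le Y

/-- The solution operator of the (conjugated) system on the unit interval. -/
noncomputable def solutionOp {κ : ℝ} (hκ : 0 < κ) {b : ℝ → ℂ} {K : ℝ} (h : IsBddCoeff b K) (z : ℂ) :
    CI × CI →L[ℂ] CI × CI :=
  Ring.inverse (1 - systemOp hκ h z)

/-- The function `e^{-κx}` on the unit interval. -/
noncomputable def decay (κ : ℝ) : CI :=
  BoundedContinuousFunction.mkOfCompact ⟨fun x => Complex.exp (-κ * (x : ℝ)), by fun_prop⟩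

/-- The initial values `(u₀, w₀)`, as a pair of functions on the unit interval. -/
noncomputable def initial (κ : ℝ) : ℂ × ℂ →L[ℂ] CI × CI :=
  ((ContinuousLinearMap.toSpanSingleton ℂ (decay κ)).comp
    (ContinuousLinearMap.fst ℂ ℂ ℂ)).prod
  ((ContinuousLinearMap.toSpanSingleton ℂ (decay κ)).comp
    (ContinuousLinearMap.snd ℂ ℂ ℂ))

/-- The values at the right end point. -/
noncomputable def endpoint (κ : ℝ) : CI × CI →L[ℂ] ℂ × ℂ :=
  Complex.exp κ • ((BoundedContinuousFunction.evalCLM ℂ (1 : unitInterval)).prodMap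
    (BoundedContinuousFunction.evalCLM ℂ (1 : unitInterval)))

/-- The monodromy operator `(u(0), w(0)) ↦ (u(1), w(1))` of the system `u' = b w`, `w' = -z u`. -/
noncomputable def monodromy {κ : ℝ} (hκ : 0 < κ) {b : ℝ → ℂ} {K : ℝ} (h : IsBddCoeff b K) (z : ℂ) :
    ℂ × ℂ →L[ℂ] ℂ × ℂ :=
  (endpoint κ).comp ((solutionOp hκ h z).comp (initial κ))

/-- Inversion is continuous at a unit, so smallness of the operator is needed only for the limit
system. Where `1 - systemOp` is not invertible, `Ring.inverse` takes the value zero, which does no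
harm to the limit. -/
lemma tendsto_monodromy {ι : Type*} {l : Filter ι} {κ : ℝ} (hκ : 0 < κ) {b : ι → ℝ → ℂ}
    {K : ι → ℝ} (h : ∀ i, IsBddCoeff (b i) (K i)) {b₀ : ℝ → ℂ} {K₀ : ℝ} (h₀ : IsBddCoeff b₀ K₀)
    {z : ι → ℂ} {z₀ : ℂ} (hz : Tendsto z l (𝓝 z₀)) {δ : ι → ℝ}
    (hδ : ∀ i, IsBddCoeff (fun t => b i t - b₀ t) (δ i)) (hδ0 : Tendsto δ l (𝓝 0))
    (hK : K₀ < κ) (hz₀ : ‖z₀‖ < κ) :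
    Tendsto (fun i => monodromy hκ (h i) (z i)) l (𝓝 (monodromy hκ h₀ z₀)) := by
  have hV : Tendsto (fun i => volterra hκ (h i)) l (𝓝 (volterra hκ h₀)) := by
    rw [tendsto_iff_norm_sub_tendsto_zero]
    refine squeeze_zero (fun _ => norm_nonneg _)
      (fun i => norm_volterra_sub_le hκ (h i) h₀ (hδ i)) ?_
    simpa using hδ0.div_const κ
  have hT : Tendsto (fun i => systemOp hκ (h i) (z i)) l (𝓝 (systemOp hκ h₀ z₀)) := by
    unfold systemOp
    refine Tendsto.sub ?_ (hz.smul_const _)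
    exact ((continuous_const.clm_comp (continuous_id.clm_comp continuous_const)).tendsto _).comp hV
  have hu := isUnit_one_sub_of_norm_lt_one (R := CI × CI →L[ℂ] CI × CI)
    (norm_systemOp_lt_one hκ h₀ hK hz₀)
  have hS : Tendsto (fun i => solutionOp hκ (h i) (z i)) l (𝓝 (solutionOp hκ h₀ z₀)) := by
    have := NormedRing.inverse_continuousAt hu.unit
    rw [IsUnit.unit_spec] at this
    exact this.tendsto.comp (tendsto_const_nhds.sub hT)
  exact ((continuous_const.clm_comp (continuous_id.clm_comp continuous_const)).tendsto _).comp hS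

lemma endpoint_apply (κ : ℝ) (Y : CI × CI) :
    endpoint κ Y = (Complex.exp κ * Y.1 1, Complex.exp κ * Y.2 1) := rfl

lemma initial_apply_fst (κ : ℝ) (U₀ : ℂ × ℂ) (x : unitInterval) :
    (initial κ U₀).1 x = U₀.1 * Complex.exp (-κ * (x : ℝ)) := rfl

lemma initial_apply_snd (κ : ℝ) (U₀ : ℂ × ℂ) (x : unitInterval) :
    (initial κ U₀).2 x = U₀.2 * Complex.exp (-κ * (x : ℝ)) := rfl

/-! ### Variation of constants on a cell. -/

/-- The function `-e^{-κx} ∫₀ˣ F`. -/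
noncomputable def forcing (κ : ℝ) {F : ℝ → ℂ} (hF : IntervalIntegrable F volume 0 1) : CI :=
  BoundedContinuousFunction.mkOfCompact
    ⟨fun x => -(Complex.exp (-κ * (x : ℝ)) * ∫ t in (0 : ℝ)..x, F t), by
      have h1 := (IsPrimOn.of_integral hF 0).continuousOn zero_le_one
      simp only [zero_add] at h1
      exact ((by fun_prop : Continuous fun x : unitInterval =>
        Complex.exp (-κ * (x : ℝ))).mul (h1.comp_continuous continuous_subtype_val
          fun x => x.2)).neg⟩

lemma forcing_apply (κ : ℝ) {F : ℝ → ℂ} (hF : IntervalIntegrable F volume 0 1)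
    (x : unitInterval) :
    forcing κ hF x = -(Complex.exp (-κ * (x : ℝ)) * ∫ t in (0 : ℝ)..x, F t) := rfl

lemma norm_forcing_le {κ : ℝ} (hκ : 0 < κ) {F : ℝ → ℂ} (hF : IntervalIntegrable F volume 0 1) :
    ‖forcing κ hF‖ ≤ ∫ t in (0 : ℝ)..1, ‖F t‖ := by
  have h0 : 0 ≤ ∫ t in (0 : ℝ)..1, ‖F t‖ :=
    intervalIntegral.integral_nonneg zero_le_one fun t _ => norm_nonneg _
  refine (BoundedContinuousFunction.norm_le h0).2 fun x => ?_
  rw [forcing_apply, norm_neg, norm_mul, Complex.norm_exp]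
  have h1 : (-(κ : ℂ) * ((x : ℝ) : ℂ)).re = -(κ * x) := by simp
  have h2 : Real.exp (-(κ * x)) ≤ 1 := by
    rw [Real.exp_le_one_iff]
    have := x.2.1
    nlinarith
  have h3 : ‖∫ t in (0 : ℝ)..x, F t‖ ≤ ∫ t in (0 : ℝ)..1, ‖F t‖ :=
    (intervalIntegral.norm_integral_le_integral_norm x.2.1).trans
      (intervalIntegral.integral_mono_interval le_rfl x.2.1 x.2.2
        (Eventually.of_forall fun t => norm_nonneg _) hF.norm)
  rw [h1]
  calc _ ≤ 1 * ∫ t in (0 : ℝ)..1, ‖F t‖ := by gcongr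
    _ = _ := one_mul _

/-- The function `e^{κx} y(x)`, extended by constants. -/
noncomputable def growth (κ : ℝ) (y : CI) (x : ℝ) : ℂ :=
  Complex.exp (κ * (projIcc (0 : ℝ) 1 zero_le_one x : ℝ)) * y.ext x

lemma continuous_growth (κ : ℝ) (y : CI) : Continuous (growth κ y) := by
  refine Continuous.mul ?_ y.continuous_ext
  have := continuous_subtype_val.comp (continuous_projIcc (a := (0 : ℝ)) (b := 1)
    (h := zero_le_one))
  exact Complex.continuous_exp.comp (continuous_const.mul (Complex.continuous_ofReal.comp this))

lemma growth_of_mem (κ : ℝ) (y : CI) {x : ℝ} (hx : x ∈ Icc (0 : ℝ) 1) :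
    growth κ y x = Complex.exp (κ * x) * y.ext x := by
  rw [growth, projIcc_of_mem _ hx]

lemma norm_growth_le {κ : ℝ} (hκ : 0 < κ) (y : CI) (x : ℝ) :
    ‖growth κ y x‖ ≤ Real.exp κ * ‖y‖ := by
  rw [growth, norm_mul, Complex.norm_exp]
  set s := projIcc (0 : ℝ) 1 zero_le_one x
  have h1 : ((κ : ℂ) * ((s : ℝ) : ℂ)).re = κ * s := by simp
  rw [h1]
  have := s.2.2
  gcongr
  · nlinarith
  · exact y.norm_ext_le x

/-- Multiplying the conjugated fixed-point equation by e^{κx} returns the integrated differential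
equation. The factor `s` lets one statement serve both rows of the system, with `s = 1` and `s =
-z`. -/
lemma isPrimOn_growth {κ : ℝ} {c : ℝ → ℂ} {K : ℝ} (hc : IsBddCoeff c K) {y v : CI} {a s : ℂ}
    {f : ℝ → ℂ} (hf : IntervalIntegrable f volume 0 1)
    (h : ∀ x : unitInterval, y x = a * Complex.exp (-κ * (x : ℝ)) +
      (Complex.exp (-κ * (x : ℝ)) * ∫ t in (0 : ℝ)..x, f t) + s * volterraFun κ c v x) :
    growth κ y 0 = a ∧ IsPrimOn (growth κ y) (fun t => f t + s * (c t * growth κ v t)) 0 1 := by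
  have h1 : ∀ x ∈ Icc (0 : ℝ) 1, growth κ y x =
      a + ∫ t in (0 : ℝ)..x, (f t + s * (c t * growth κ v t)) := by
    intro x hx
    rw [growth_of_mem κ y hx, y.ext_of_mem hx, h, volterraFun, intervalIntegral.integral_add,
      intervalIntegral.integral_const_mul]
    · have e1 : ∫ t in (0 : ℝ)..x, c t * growth κ v t =
          ∫ t in (0 : ℝ)..x, c t * (Complex.exp (κ * t) * v.ext t) := by
        refine intervalIntegral.integral_congr fun t ht => ?_
        rw [uIcc_of_le hx.1] at ht
        simp only [growth_of_mem κ v ⟨ht.1, ht.2.trans hx.2⟩]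
      rw [e1]
      have e2 : Complex.exp (κ * x) * Complex.exp (-κ * x) = 1 := by
        rw [← Complex.exp_add]
        simp
      simp only
      linear_combination (a + (∫ t in (0 : ℝ)..x, f t) +
        s * ∫ t in (0 : ℝ)..x, c t * (Complex.exp (κ * t) * v.ext t)) * e2
    · exact hf.mono_set (by
        rw [uIcc_of_le hx.1, uIcc_of_le zero_le_one]; exact Icc_subset_Icc_right hx.2)
    · exact (hc.intervalIntegrable_mul (continuous_growth κ v) hx).const_mul s
  have h0 : growth κ y 0 = a := by simpa using h1 0 (by simp)
  exact ⟨h0, hf.add ((hc.intervalIntegrable_mul (continuous_growth κ v) (by simp)).const_mul s),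
    fun x hx => by rw [h1 x hx, h0]⟩

/-- Variation of constants on the unit cell: the inhomogeneous system `u' = b w`, `w' = -(z u + F)`
can be solved for all initial values, with bounds, and the values at the right end point are given
by the monodromy operator up to a contribution of `F`. -/
theorem exists_cell_solution {κ : ℝ} (hκ : 0 < κ) {b : ℝ → ℂ} {K : ℝ} (h : IsBddCoeff b K) {z : ℂ}
    (hK : K < κ) (hz : ‖z‖ < κ) :
    ∃ C : ℝ, 0 ≤ C ∧ ∀ F : ℝ → ℂ, IntervalIntegrable F volume 0 1 →
      ∃ d : ℂ × ℂ, ‖d‖ ≤ C * ∫ t in (0 : ℝ)..1, ‖F t‖ ∧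
        ∀ U₀ : ℂ × ℂ, ∃ u w : ℝ → ℂ, Continuous u ∧ Continuous w ∧
          IsPrimOn u (fun t => b t * w t) 0 1 ∧ IsPrimOn w (fun t => -(z * u t + F t)) 0 1 ∧
          u 0 = U₀.1 ∧ w 0 = U₀.2 ∧ (u 1, w 1) = monodromy hκ h z U₀ + d ∧
          ∀ x, ‖u x‖ ≤ C * (‖U₀‖ + ∫ t in (0 : ℝ)..1, ‖F t‖) ∧
            ‖w x‖ ≤ C * (‖U₀‖ + ∫ t in (0 : ℝ)..1, ‖F t‖) := by
  set S := solutionOp hκ h z with hSdef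
  have hS : ∀ G, S G - systemOp hκ h z (S G) = G := by
    intro G
    have hu := isUnit_one_sub_of_norm_lt_one (R := CI × CI →L[ℂ] CI × CI)
      (norm_systemOp_lt_one hκ h hK hz)
    have := congrArg (fun A : CI × CI →L[ℂ] CI × CI => A G) (Ring.mul_inverse_cancel _ hu)
    exact this
  -- The first summand bounds the contribution of `F` at the right end point, the second bounds the
  -- solution throughout the cell.
  refine ⟨‖endpoint κ‖ * ‖S‖ + Real.exp κ * (‖S‖ * (‖initial κ‖ + 1)), by positivity,
    fun F hF => ?_⟩
  set I := ∫ t in (0 : ℝ)..1, ‖F t‖ with hI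
  have hI0 : 0 ≤ I := intervalIntegral.integral_nonneg zero_le_one fun t _ => norm_nonneg _
  set Φ : CI × CI := (0, forcing κ hF) with hΦ
  have hΦn : ‖Φ‖ ≤ I := by
    rw [hΦ, Prod.norm_def]
    simpa using norm_forcing_le hκ hF
  -- This is the end value of the solution with zero initial data; by linearity it is the same
  -- correction for all `U₀`.
  refine ⟨endpoint κ (S Φ), ?_, fun U₀ => ?_⟩
  · calc ‖endpoint κ (S Φ)‖ ≤ ‖endpoint κ‖ * (‖S‖ * I) := by
          refine ((endpoint κ).le_opNorm _).trans ?_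
          gcongr
          exact (S.le_opNorm _).trans (by gcongr)
      _ ≤ _ := by
          rw [add_mul, mul_assoc]
          exact le_add_of_nonneg_right (by positivity)
  set Y := S (initial κ U₀ + Φ) with hY
  have hYeq : ∀ Z : CI × CI, Z = Y → Z = initial κ U₀ + Φ + systemOp hκ h z Y := by
    rintro _ rfl
    rw [← sub_eq_iff_eq_add]
    exact hS _
  have hYn : ‖Y‖ ≤ ‖S‖ * (‖initial κ‖ + 1) * (‖U₀‖ + I) := by
    refine (S.le_opNorm _).trans ?_
    rw [mul_assoc]
    gcongr
    calc ‖initial κ U₀ + Φ‖ ≤ ‖initial κ‖ * ‖U₀‖ + I :=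
          (norm_add_le _ _).trans (add_le_add ((initial κ).le_opNorm _) hΦn)
      _ ≤ _ := by
          have := norm_nonneg (initial κ)
          have := norm_nonneg U₀
          nlinarith
  have hb : ∀ y : CI, ‖y‖ ≤ ‖Y‖ → ∀ x, ‖growth κ y x‖ ≤
      (‖endpoint κ‖ * ‖S‖ + Real.exp κ * (‖S‖ * (‖initial κ‖ + 1))) * (‖U₀‖ + I) := by
    intro y hy x
    calc ‖growth κ y x‖ ≤ Real.exp κ * ‖y‖ := norm_growth_le hκ y x
      _ ≤ Real.exp κ * (‖S‖ * (‖initial κ‖ + 1) * (‖U₀‖ + I)) := by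
          gcongr
          exact hy.trans hYn
      _ = Real.exp κ * (‖S‖ * (‖initial κ‖ + 1)) * (‖U₀‖ + I) := by ring
      _ ≤ _ := by
          gcongr
          exact le_add_of_nonneg_left (by positivity)
  have h1 := isPrimOn_growth (κ := κ) h (y := Y.1) (v := Y.2) (a := U₀.1) (s := 1)
    (f := fun _ => 0) intervalIntegrable_const (fun x => by
      have := congrArg (fun Z : CI × CI => Z.1 x) (hYeq Y rfl)
      simp only [systemOp_apply, Prod.fst_add, BoundedContinuousFunction.add_apply,
        initial_apply_fst, volterra_apply, hΦ] at this
      simpa using this)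
  have h2 := isPrimOn_growth (κ := κ) IsBddCoeff.one (y := Y.2) (v := Y.1) (a := U₀.2) (s := -z)
    (f := fun t => -F t) hF.neg (fun x => by
      have := congrArg (fun Z : CI × CI => Z.2 x) (hYeq Y rfl)
      simp only [systemOp_apply, Prod.snd_add, BoundedContinuousFunction.add_apply,
        BoundedContinuousFunction.neg_apply, BoundedContinuousFunction.smul_apply, smul_eq_mul,
        initial_apply_snd, volterra_apply, hΦ, forcing_apply] at this
      rw [this, intervalIntegral.integral_neg]
      ring)
  refine ⟨growth κ Y.1, growth κ Y.2, continuous_growth κ _, continuous_growth κ _, ?_, ?_, h1.1,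
    h2.1, ?_, fun x => ⟨hb _ (norm_fst_le Y) x, hb _ (norm_snd_le Y) x⟩⟩
  · convert h1.2 using 2
    ring
  · convert h2.2 using 2
    ring
  · have e : monodromy hκ h z U₀ + endpoint κ (S Φ) = endpoint κ Y := by
      rw [hY, map_add, map_add]
      rfl
    have hone : (1 : ℝ) ∈ Icc (0 : ℝ) 1 := by simp
    rw [e, endpoint_apply, growth_of_mem κ _ hone, growth_of_mem κ _ hone,
      CI.ext_of_mem _ hone, CI.ext_of_mem _ hone]
    simp only [Complex.ofReal_one, mul_one]
    rfl

/-! ### Linear recursions in ℓ²(ℤ). -/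

/-- Treating ℓ²(ℤ) as `L²` of the counting measure makes composition with measure-preserving maps
available, both for shifts and for the floor map. -/
lemma memLp_two_count_iff {f : ℤ → ℂ} :
    MemLp f 2 (Measure.count : Measure ℤ) ↔ Summable fun n => ‖f n‖ ^ 2 := by
  rw [memLp_two_iff_integrable_sq_norm (measurable_of_countable f).aestronglyMeasurable,
    integrable_count_iff]
  simp

lemma eq_of_ae_count {f g : ℤ → ℂ} (h : f =ᵐ[Measure.count] g) (n : ℤ) : f n = g n := by
  by_contra hne
  have h1 : (Measure.count : Measure ℤ) {m | ¬ f m = g m} = 0 := h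
  rw [Measure.count_eq_zero_iff] at h1
  exact (h1 ▸ (show n ∈ {m | ¬ f m = g m} from hne) : n ∈ (∅ : Set ℤ))

/-- The shift `c ↦ c (· + a)` on `ℓ²(ℤ)`. -/
noncomputable def shiftL2 (a : ℤ) :
    Lp ℂ 2 (Measure.count : Measure ℤ) →L[ℂ] Lp ℂ 2 (Measure.count : Measure ℤ) :=
  (Lp.compMeasurePreservingₗᵢ ℂ (fun n : ℤ => n + a)
    (measurePreserving_add_right Measure.count a)).toContinuousLinearMap

lemma shiftL2_apply (a : ℤ) (c : Lp ℂ 2 (Measure.count : Measure ℤ)) (n : ℤ) :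
    shiftL2 a c n = c (n + a) :=
  eq_of_ae_count (Lp.coeFn_compMeasurePreserving c (measurePreserving_add_right Measure.count a)) n

lemma norm_shiftL2_le (a : ℤ) : ‖shiftL2 a‖ ≤ 1 :=
  LinearIsometry.norm_toContinuousLinearMap_le _

/-- The equation `c - ν S c = d` can be solved in `ℓ²(ℤ)` for shifts `S` and `|ν| < 1`. -/
lemma exists_shift_solution {ν : ℂ} (hν : ‖ν‖ < 1) (a : ℤ) {d : ℤ → ℂ}
    (hd : Summable fun n => ‖d n‖ ^ 2) :
    ∃ c : ℤ → ℂ, (Summable fun n => ‖c n‖ ^ 2) ∧ ∀ n, c n - ν * c (n + a) = d n := by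
  have hn : ‖ν • shiftL2 a‖ < 1 := by
    rw [norm_smul]
    calc ‖ν‖ * ‖shiftL2 a‖ ≤ ‖ν‖ * 1 := by gcongr; exact norm_shiftL2_le a
      _ < 1 := by linarith
  have hu := isUnit_one_sub_of_norm_lt_one
    (R := Lp ℂ 2 (Measure.count : Measure ℤ) →L[ℂ] Lp ℂ 2 (Measure.count : Measure ℤ)) hn
  have hdm := memLp_two_count_iff.2 hd
  set D : Lp ℂ 2 (Measure.count : Measure ℤ) := hdm.toLp d
  set c := Ring.inverse (1 - ν • shiftL2 a) D
  have hc : c - ν • shiftL2 a c = D :=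
    congrArg (fun A : Lp ℂ 2 (Measure.count : Measure ℤ) →L[ℂ] _ => A D)
      (Ring.mul_inverse_cancel _ hu)
  refine ⟨c, memLp_two_count_iff.1 (Lp.memLp c), fun n => ?_⟩
  have h1 := eq_of_ae_count (Lp.coeFn_sub c (ν • shiftL2 a c)) n
  have h2 := eq_of_ae_count (Lp.coeFn_smul ν (shiftL2 a c)) n
  have h3 := eq_of_ae_count hdm.coeFn_toLp n
  rw [hc] at h1
  rw [Pi.smul_apply, smul_eq_mul, shiftL2_apply] at h2
  rw [Pi.sub_apply, h2] at h1
  rw [← h1, h3]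

/-- For `‖μ‖ < 1` the recursion is solved from the past, for `‖μ‖ > 1` it is divided by `μ` and
solved from the future; either way a Neumann series in a shift converges. -/
lemma exists_scalar_recursion {μ : ℂ} (hμ : ‖μ‖ ≠ 1) {d : ℤ → ℂ}
    (hd : Summable fun n => ‖d n‖ ^ 2) :
    ∃ c : ℤ → ℂ, (Summable fun n => ‖c n‖ ^ 2) ∧ ∀ n, c (n + 1) = μ * c n + d n := by
  rcases lt_or_gt_of_ne hμ with h | h
  · obtain ⟨c, hc, h1⟩ := exists_shift_solution h (-1) hd
    refine ⟨fun n => c (n - 1), hc.comp_injective (sub_left_injective (b := (1 : ℤ))), fun n => ?_⟩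
    have := h1 n
    simp only [add_sub_cancel_right]
    rw [← sub_eq_add_neg] at this
    linear_combination this
  · have h0 : μ ≠ 0 := norm_pos_iff.1 (zero_lt_one.trans h)
    have h2 : ‖μ⁻¹‖ < 1 := by
      rw [norm_inv]
      exact inv_lt_one_of_one_lt₀ h
    have hd' : Summable fun n => ‖-μ⁻¹ * d n‖ ^ 2 := by
      simp only [norm_mul, mul_pow]
      exact hd.mul_left _
    obtain ⟨c, hc, h1⟩ := exists_shift_solution h2 1 hd'
    refine ⟨c, hc, fun n => ?_⟩
    have := h1 n
    field_simp at this
    linear_combination -this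

lemma summable_norm_sq_add {f g : ℤ → ℂ} (hf : Summable fun n => ‖f n‖ ^ 2)
    (hg : Summable fun n => ‖g n‖ ^ 2) : Summable fun n => ‖f n + g n‖ ^ 2 :=
  memLp_two_count_iff.1 ((memLp_two_count_iff.2 hf).add (memLp_two_count_iff.2 hg))

lemma summable_norm_sq_mul {f : ℤ → ℂ} (hf : Summable fun n => ‖f n‖ ^ 2) (a : ℂ) :
    Summable fun n => ‖a * f n‖ ^ 2 := by
  simp only [norm_mul, mul_pow]
  exact hf.mul_left _

lemma summable_norm_sq_succ {f : ℤ → ℂ} (hf : Summable fun n => ‖f n‖ ^ 2) :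
    Summable fun n => ‖f (n + 1)‖ ^ 2 :=
  hf.comp_injective (add_left_injective (1 : ℤ))

/-- If `L` has no eigenvalue on the unit circle, the recursion `U (n + 1) = L (U n) + d n` can be
solved in `ℓ²(ℤ)`. -/
theorem exists_recursion_solution (L : ℂ × ℂ →L[ℂ] ℂ × ℂ)
    (hL : ∀ μ : ℂ, ‖μ‖ = 1 → ∀ v, L v = μ • v → v = 0) {d : ℤ → ℂ × ℂ}
    (hd : Summable fun n => ‖d n‖ ^ 2) :
    ∃ U : ℤ → ℂ × ℂ, (Summable fun n => ‖U n‖ ^ 2) ∧ ∀ n, U (n + 1) = L (U n) + d n := by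
  obtain ⟨a, b, c, e, hLv⟩ : ∃ a b c e : ℂ, ∀ x y, L (x, y) = (a * x + b * y, c * x + e * y) := by
    refine ⟨(L (1, 0)).1, (L (0, 1)).1, (L (1, 0)).2, (L (0, 1)).2, fun x y => ?_⟩
    have h1 : ((x, y) : ℂ × ℂ) = x • ((1, 0) : ℂ × ℂ) + y • ((0, 1) : ℂ × ℂ) := by simp
    rw [h1, map_add, map_smul, map_smul]
    ext <;> simp <;> ring
  -- At a root, `(b, μ - a)` and `(μ - e, c)` both solve the eigenvector equation. If both vanish,
  -- `L` is `μ` times the identity and `(1, 0)` is an eigenvector.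
  have hroot : ∀ μ : ℂ, μ ^ 2 - (a + e) * μ + (a * e - b * c) = 0 → ‖μ‖ ≠ 1 := by
    intro μ hμ h1
    have hv : ∀ x y, L (x, y) = μ • (x, y) → x = 0 ∧ y = 0 := fun x y h =>
      Prod.mk_eq_zero.1 (hL μ h1 _ h)
    have e1 := hv b (μ - a) (by
      rw [hLv, Prod.smul_mk, smul_eq_mul, smul_eq_mul, Prod.mk.injEq]
      exact ⟨by ring, by linear_combination -hμ⟩)
    have e2 := hv (μ - e) c (by
      rw [hLv, Prod.smul_mk, smul_eq_mul, smul_eq_mul, Prod.mk.injEq]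
      exact ⟨by linear_combination -hμ, by ring⟩)
    have e3 := hv 1 0 (by
      rw [hLv, Prod.smul_mk, smul_eq_mul, smul_eq_mul, Prod.mk.injEq]
      exact ⟨by linear_combination -e1.2, by linear_combination e2.2⟩)
    exact one_ne_zero e3.1
  obtain ⟨μ, hμ⟩ : ∃ μ : ℂ, μ ^ 2 - (a + e) * μ + (a * e - b * c) = 0 := by
    obtain ⟨s, hs⟩ := IsAlgClosed.exists_pow_nat_eq ((a + e) ^ 2 - 4 * (a * e - b * c))
      (n := 2) (by norm_num)
    exact ⟨(a + e + s) / 2, by linear_combination hs / 4⟩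
  have hμ2 : ‖a + e - μ‖ ≠ 1 := hroot _ (by linear_combination hμ)
  -- With the shift S, the characteristic polynomial of `L` at S factors as (S - μ)(S - (a + e -
  -- μ)), so it is inverted by two scalar recursions.
  have key : ∀ f : ℤ → ℂ, (Summable fun n => ‖f n‖ ^ 2) → ∃ g : ℤ → ℂ,
      (Summable fun n => ‖g n‖ ^ 2) ∧
        ∀ n, g (n + 1 + 1) - (a + e) * g (n + 1) + (a * e - b * c) * g n = f n := by
    intro f hf
    obtain ⟨k, hk, hk'⟩ := exists_scalar_recursion hμ2 hf
    obtain ⟨g, hg, hg'⟩ := exists_scalar_recursion (hroot μ hμ) hk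
    refine ⟨g, hg, fun n => ?_⟩
    have e1 := hk' n
    have e2 := hg' n
    have e3 := hg' (n + 1)
    linear_combination e3 + e1 - (a + e - μ) * e2 + g n * hμ
  have hd1 : Summable fun n => ‖(d n).1‖ ^ 2 :=
    hd.of_nonneg_of_le (fun n => by positivity) fun n => by gcongr; exact norm_fst_le _
  have hd2 : Summable fun n => ‖(d n).2‖ ^ 2 :=
    hd.of_nonneg_of_le (fun n => by positivity) fun n => by gcongr; exact norm_snd_le _
  obtain ⟨x, hx, hx'⟩ := key _ hd1
  obtain ⟨y, hy, hy'⟩ := key _ hd2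
  have hx1 : Summable fun n => ‖x (n + 1)‖ ^ 2 := summable_norm_sq_succ hx
  have hy1 : Summable fun n => ‖y (n + 1)‖ ^ 2 := summable_norm_sq_succ hy
  -- This is the adjugate of S - L applied to (x, y). By Cramer's rule, S - L maps it to the
  -- characteristic polynomial of `L` at S applied to (x, y), which is `d`.
  refine ⟨fun n => (x (n + 1) + (-e * x n + b * y n), y (n + 1) + (c * x n + -a * y n)), ?_, ?_⟩
  · have h1 := summable_norm_sq_add hx1
      (summable_norm_sq_add (summable_norm_sq_mul hx (-e)) (summable_norm_sq_mul hy b))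
    have h2 := summable_norm_sq_add hy1
      (summable_norm_sq_add (summable_norm_sq_mul hx c) (summable_norm_sq_mul hy (-a)))
    refine (h1.add h2).of_nonneg_of_le (fun n => by positivity) fun n => ?_
    rw [Prod.norm_def]
    rcases max_choice ‖x (n + 1) + (-e * x n + b * y n)‖ ‖y (n + 1) + (c * x n + -a * y n)‖
      with h | h <;> simp only [h]
    · exact le_add_of_nonneg_right (by positivity)
    · exact le_add_of_nonneg_left (by positivity)
  · intro n
    rw [hLv]
    ext
    · simp only [Prod.fst_add]
      linear_combination hx' n
    · simp only [Prod.snd_add]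
      linear_combination hy' n

/-! ### From the cells to the line. -/

/-- Functions that are constant on the cells [n, n + 1) thereby have equal `L²(ℝ)` and ℓ²(ℤ) norms;
such a function will dominate the glued solution. -/
lemma measurePreserving_floor :
    MeasurePreserving (Int.floor : ℝ → ℤ) volume Measure.count := by
  refine ⟨Int.measurable_floor, Measure.ext_of_singleton fun n => ?_⟩
  rw [Measure.map_apply Int.measurable_floor (measurableSet_singleton n), Int.preimage_floor_singleton,
    Real.volume_Ico, Measure.count_singleton]
  simp

lemma IsPrimOn.congr {u g v k : ℝ → ℂ} {a b : ℝ} (h : IsPrimOn u g a b) (hab : a ≤ b)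
    (hu : EqOn u v (Icc a b)) (hg : EqOn g k (Ioo a b)) : IsPrimOn v k a b := by
  have h1 : IsPrimOn v g a b := ⟨h.integrable, fun x hx => by
    rw [← hu hx, ← hu (left_mem_Icc.2 hab)]
    exact h.eq x hx⟩
  exact h1.congr_deriv hab ((ae_restrict_iff' measurableSet_Ioo).2 (Eventually.of_forall hg))

lemma IsPrimOn.comp_sub_right {u g : ℝ → ℂ} {a b : ℝ} (h : IsPrimOn u g a b) (c : ℝ) :
    IsPrimOn (fun x => u (x - c)) (fun x => g (x - c)) (a + c) (b + c) := by
  refine ⟨h.integrable.comp_sub_right c, fun x hx => ?_⟩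
  rw [h.eq (x - c) ⟨by linarith [hx.1], by linarith [hx.2]⟩,
    intervalIntegral.integral_comp_sub_right (fun t => g t), add_sub_cancel_right]

/-- The difference of `u` and the primitive of `g` is constant on each closed cell, and neighbouring
cells share an end point. -/
lemma isPrimOn_of_forall_int {u g : ℝ → ℂ} (hg : LocallyIntegrable g)
    (h : ∀ n : ℤ, IsPrimOn u g n (n + 1)) (a b : ℝ) : IsPrimOn u g a b := by
  set v : ℝ → ℂ := fun y => u y - ∫ t in (0 : ℝ)..y, g t with hv
  have hcell : ∀ n : ℤ, ∀ y ∈ Icc (n : ℝ) (n + 1), v y = v n := by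
    intro n y hy
    simp only [hv]
    rw [(h n).eq y hy, ← intervalIntegral.integral_add_adjacent_intervals
      (hg.intervalIntegrable_volume 0 n) (hg.intervalIntegrable_volume n y)]
    ring
  have hsucc : ∀ n : ℤ, v ((n + 1 : ℤ) : ℝ) = v n := fun n =>
    hcell n _ ⟨by push_cast; linarith, by push_cast; exact le_rfl⟩
  have hint : ∀ n : ℤ, v n = v 0 := by
    intro n
    induction n using Int.induction_on with
    | zero => simp
    | succ n ih => rw [hsucc, ih]
    | pred n ih =>
      have := hsucc (-n - 1)
      rw [sub_add_cancel] at this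
      rw [← this, ih]
  have hall : ∀ y, v y = v 0 := fun y => by
    rw [hcell ⌊y⌋ y ⟨Int.floor_le y, (Int.lt_floor_add_one y).le⟩, hint]
  refine ⟨hg.intervalIntegrable_volume a b, fun x _ => ?_⟩
  have e1 := (hall x).trans (hall a).symm
  simp only [hv] at e1
  rw [← intervalIntegral.integral_interval_sub_left (hg.intervalIntegrable_volume 0 x)
    (hg.intervalIntegrable_volume 0 a)]
  linear_combination e1

/-- Nonnegativity of the variance of `f` on the unit interval. -/
lemma sq_integral_le_integral_sq {f : ℝ → ℝ} (hf : IntervalIntegrable f volume 0 1)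
    (hf2 : IntervalIntegrable (fun t => f t ^ 2) volume 0 1) :
    (∫ t in (0 : ℝ)..1, f t) ^ 2 ≤ ∫ t in (0 : ℝ)..1, f t ^ 2 := by
  set I := ∫ t in (0 : ℝ)..1, f t with hI
  have h0 : 0 ≤ ∫ t in (0 : ℝ)..1, (f t - I) ^ 2 :=
    intervalIntegral.integral_nonneg zero_le_one fun t _ => sq_nonneg _
  have h1 : ∫ t in (0 : ℝ)..1, (f t - I) ^ 2 = (∫ t in (0 : ℝ)..1, f t ^ 2) - 2 * I * I + I ^ 2 := by
    have e : ∀ t, (f t - I) ^ 2 = f t ^ 2 - 2 * I * f t + I ^ 2 := fun t => by ring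
    simp only [e]
    rw [intervalIntegral.integral_add (hf2.sub (hf.const_mul _)) intervalIntegrable_const,
      intervalIntegral.integral_sub hf2 (hf.const_mul _), intervalIntegral.integral_const_mul]
    simp [hI]
  nlinarith

lemma summable_sq_integral_norm {F : ℝ → ℂ} (hF : MemLp F 2) :
    Summable fun n : ℤ => (∫ t in (0 : ℝ)..1, ‖F (t + n)‖) ^ 2 := by
  have h2 : Integrable fun t => ‖F t‖ ^ 2 := (memLp_two_iff_integrable_sq_norm hF.1).1 hF
  refine (h2.hasSum_intervalIntegral_comp_add_int).summable.of_nonneg_of_le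
    (fun n => by positivity) fun n => ?_
  refine sq_integral_le_integral_sq ?_ ?_
  · have := (hF.locallyIntegrable_two.intervalIntegrable_volume (0 + n) (1 + n)).norm
    simpa using this.comp_add_right (n : ℝ)
  · exact (h2.comp_add_right (n : ℝ)).intervalIntegrable

/-- If the monodromy operator of the periodic system `U' = b W`, `W' = -z U` has no eigenvalue on
the unit circle, the inhomogeneous system can be solved in `L²(ℝ)`. -/
theorem exists_line_solution {κ : ℝ} (hκ : 0 < κ) {b : ℝ → ℂ} {K : ℝ} (h : IsBddCoeff b K) {z : ℂ}
    (hK : K < κ) (hz : ‖z‖ < κ) (hper : Function.Periodic b 1) (hbm : AEStronglyMeasurable b)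
    (hbK : ∀ᵐ t, ‖b t‖ ≤ K)
    (hL : ∀ μ : ℂ, ‖μ‖ = 1 → ∀ v, monodromy hκ h z v = μ • v → v = 0)
    {F : ℝ → ℂ} (hF : MemLp F 2) :
    ∃ U W : ℝ → ℂ, MemLp U 2 ∧ MemLp W 2 ∧
      (∀ x y, IsPrimOn U (fun t => b t * W t) x y) ∧
      ∀ x y, IsPrimOn W (fun t => -(z * U t + F t)) x y := by
  obtain ⟨C, hC, hsol⟩ := exists_cell_solution hκ h hK hz
  have hFi : ∀ n : ℤ, IntervalIntegrable (fun t => F (t + n)) volume 0 1 := fun n => by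
    have := hF.locallyIntegrable_two.intervalIntegrable_volume (0 + n) (1 + n)
    simpa using this.comp_add_right (n : ℝ)
  choose d hd hsol using fun n : ℤ => hsol _ (hFi n)
  set I : ℤ → ℝ := fun n => ∫ t in (0 : ℝ)..1, ‖F (t + n)‖ with hI
  have hI0 : ∀ n, 0 ≤ I n := fun n =>
    intervalIntegral.integral_nonneg zero_le_one fun t _ => norm_nonneg _
  have hIs : Summable fun n => I n ^ 2 := summable_sq_integral_norm hF
  have hds : Summable fun n => ‖d n‖ ^ 2 := by
    refine (hIs.mul_left (C ^ 2)).of_nonneg_of_le (fun n => by positivity) fun n => ?_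
    rw [← mul_pow]
    gcongr
    exact hd n
  -- Taking `V n` as the initial value on cell `n`, the recursion says that the end value on one
  -- cell is the initial value on the next.
  obtain ⟨V, hVs, hV⟩ := exists_recursion_solution (monodromy hκ h z) hL hds
  choose u w hu hw hpu hpw hu0 hw0 h1 hb using fun n : ℤ => hsol n (V n)
  -- The cellwise bound of the solution, as a square summable sequence.
  set s : ℤ → ℂ := fun n => C * ((‖V n‖ : ℂ) + (I n : ℂ)) with hs
  have hss : Summable fun n => ‖s n‖ ^ 2 := by
    refine summable_norm_sq_mul (summable_norm_sq_add ?_ ?_) C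
    · simpa using hVs
    · simpa using hIs
  have hsn : ∀ n, ‖s n‖ = C * (‖V n‖ + I n) := fun n => by
    rw [hs]
    simp only
    rw [← Complex.ofReal_add, ← Complex.ofReal_mul, Complex.norm_real, Real.norm_eq_abs,
      abs_of_nonneg (mul_nonneg hC (add_nonneg (norm_nonneg _) (hI0 n)))]
  have hsL : MemLp (s ∘ Int.floor) 2 (volume : Measure ℝ) :=
    (memLp_two_count_iff.2 hss).comp_measurePreserving measurePreserving_floor
  have hmeas : ∀ f : ℤ → ℝ → ℂ, (∀ n, Continuous (f n)) →
      Measurable fun y : ℝ => f ⌊y⌋ (Int.fract y) := by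
    intro f hf
    have : Measurable (fun q : ℤ × ℝ => f q.1 q.2) :=
      measurable_from_prod_countable_right fun n => (hf n).measurable
    exact this.comp (Int.measurable_floor.prodMk measurable_fract)
  set U : ℝ → ℂ := fun y => u ⌊y⌋ (Int.fract y) with hU
  set W : ℝ → ℂ := fun y => w ⌊y⌋ (Int.fract y) with hW
  have hUL : MemLp U 2 := hsL.mono (hmeas u hu).aestronglyMeasurable
    (Eventually.of_forall fun y => by
      rw [Function.comp_apply, hsn]
      exact (hb _ _).1)
  have hWL : MemLp W 2 := hsL.mono (hmeas w hw).aestronglyMeasurable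
    (Eventually.of_forall fun y => by
      rw [Function.comp_apply, hsn]
      exact (hb _ _).2)
  have hbW : MemLp (fun t => b t * W t) 2 := by
    refine hWL.of_le_mul (c := K) (hbm.mul hWL.1) ?_
    filter_upwards [hbK] with t ht
    rw [norm_mul]
    gcongr
  have hzU : MemLp (fun t => -(z * U t + F t)) 2 := ((hUL.const_mul z).add hF).neg
  have hfl : ∀ (n : ℤ) (y : ℝ), y ∈ Ico (n : ℝ) (n + 1) → ⌊y⌋ = n ∧ Int.fract y = y - n := by
    intro n y hy
    have := Int.floor_eq_iff.2 hy
    exact ⟨this, by rw [Int.fract, this]⟩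
  have hcont : ∀ n : ℤ, (u (n + 1) 0, w (n + 1) 0) = (u n 1, w n 1) := fun n => by
    rw [hu0, hw0, h1, hV]
  -- At the right end point of cell `n` the floor is already `n + 1`; the matching condition makes
  -- the two descriptions agree there.
  have hglue : ∀ f : ℤ → ℝ → ℂ, (∀ n, f (n + 1) 0 = f n 1) → ∀ n : ℤ,
      ∀ y ∈ Icc (n : ℝ) (n + 1), f n (y - n) = f ⌊y⌋ (Int.fract y) := by
    intro f hf n y hy
    rcases eq_or_lt_of_le hy.2 with h2 | h2
    · have h3 := hfl (n + 1) y ⟨by push_cast; exact h2.ge, by push_cast; linarith⟩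
      rw [h3.1, h3.2, h2]
      push_cast
      rw [sub_self, hf, add_sub_cancel_left]
    · have h3 := hfl n y ⟨hy.1, h2⟩
      rw [h3.1, h3.2]
  have hUg := hglue u fun n => congrArg Prod.fst (hcont n)
  have hWg := hglue w fun n => congrArg Prod.snd (hcont n)
  refine ⟨U, W, hUL, hWL, isPrimOn_of_forall_int hbW.locallyIntegrable_two fun n => ?_,
    isPrimOn_of_forall_int hzU.locallyIntegrable_two fun n => ?_⟩
  · have := (hpu n).comp_sub_right n
    rw [zero_add, add_comm (1 : ℝ)] at this
    refine this.congr (by linarith) (hUg n) fun t ht => ?_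
    simp only
    rw [hWg n t (Ioo_subset_Icc_self ht), show t - (n : ℝ) = t - n • (1 : ℝ) by simp,
      hper.sub_zsmul_eq]
  · have := (hpw n).comp_sub_right n
    rw [zero_add, add_comm (1 : ℝ)] at this
    refine this.congr (by linarith) (hWg n) fun t ht => ?_
    simp only
    rw [hUg n t (Ioo_subset_Icc_self ht), sub_add_cancel]

/-! ### A resolvent from surjectivity and symmetry. -/

/-- The bilinear pairing `∫ f g` in `L²(ℝ)`. -/
noncomputable def pairing (f g : L2 univ) : ℂ := inner ℂ (star f) g

lemma inner_eq_integral {U : Set ℝ} (f g : L2 U) :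
    inner ℂ f g = ∫ x in U, g x * conj (f x) := by
  rw [L2.inner_def]
  simp only [RCLike.inner_apply]

lemma pairing_eq (f g : L2 univ) : pairing f g = ∫ x in univ, g x * f x := by
  rw [pairing, inner_eq_integral]
  refine integral_congr_ae ?_
  filter_upwards [Lp.coeFn_star f] with x hx
  rw [hx, Pi.star_apply, RCLike.star_def, Complex.conj_conj]

lemma pairing_comm (f g : L2 univ) : pairing f g = pairing g f := by
  simp only [pairing_eq, mul_comm]

lemma pairing_add (f g h : L2 univ) : pairing f (g + h) = pairing f g + pairing f h :=
  inner_add_right _ _ _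

lemma pairing_sub (f g h : L2 univ) : pairing f (g - h) = pairing f g - pairing f h :=
  inner_sub_right _ _ _

lemma pairing_smul (f g : L2 univ) (c : ℂ) : pairing f (c • g) = c * pairing f g :=
  inner_smul_right _ _ _

lemma eq_of_pairing_eq {f g : L2 univ} (h : ∀ k, pairing k f = pairing k g) : f = g := by
  refine ext_inner_left ℂ fun v => ?_
  have := h (star v)
  rwa [pairing, pairing, star_star] at this

/-- If `A - z` is onto for an operator `A` in `L²(ℝ)`, given by its graph `G`, which is symmetric
with respect to `∫ f g`, then `z` is not in the spectrum. -/
theorem notMem_opSpectrum_of_surjective {G : Set (L2 univ × L2 univ)} {z : ℂ}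
    (hsymm : ∀ u g v h, (u, g) ∈ G → (v, h) ∈ G → pairing v g = pairing u h)
    (hsurj : ∀ f, ∃ u, (u, f + z • u) ∈ G) : z ∉ opSpectrum G := by
  choose R hR using hsurj
  -- The two terms with `z` cancel because the pairing is bilinear, so `z` need not be real.
  -- Symmetry then forces the chosen right inverse to be linear, and bounded by the closed graph
  -- theorem.
  have hsym : ∀ f g, pairing g (R f) = pairing (R g) f := by
    intro f g
    have := hsymm _ _ _ _ (hR f) (hR g)
    rw [pairing_add, pairing_add, pairing_smul, pairing_smul, pairing_comm (R g) (R f)] at this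
    rw [pairing_comm g, ← add_right_cancel this]
  let T : L2 univ →ₗ[ℂ] L2 univ :=
    { toFun := R
      map_add' := fun f g => eq_of_pairing_eq fun k => by
        rw [hsym, pairing_add, pairing_add, hsym, hsym]
      map_smul' := fun c f => eq_of_pairing_eq fun k => by
        rw [hsym, pairing_smul, RingHom.id_apply, pairing_smul, hsym] }
  have hT : Continuous T := by
    refine T.continuous_of_seq_closed_graph fun u x y hu hTu => ?_
    refine eq_of_pairing_eq fun k => ?_
    have h1 : Tendsto (fun n => pairing k (T (u n))) atTop (𝓝 (pairing k y)) :=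
      ((continuous_const.inner continuous_id).tendsto y).comp hTu
    have h2 : Tendsto (fun n => pairing (R k) (u n)) atTop (𝓝 (pairing (R k) x)) :=
      ((continuous_const.inner continuous_id).tendsto x).comp hu
    have h3 : (fun n => pairing k (T (u n))) = fun n => pairing (R k) (u n) :=
      funext fun n => hsym _ _
    rw [h3] at h1
    rw [tendsto_nhds_unique h1 h2]
    exact (hsym _ _).symm
  rw [opSpectrum, mem_ofPred_eq, not_not]
  refine ⟨⟨T, hT⟩, hR, fun u g hu => eq_of_pairing_eq fun k => ?_⟩
  change pairing k (R (g - z • u)) = pairing k u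
  have := hsymm _ _ _ _ hu (hR k)
  rw [pairing_add, pairing_smul] at this
  rw [hsym, pairing_sub, pairing_smul, this, pairing_comm u k, pairing_comm u (R k)]
  ring

lemma star_mem_H1_univ {v dv : L2 univ} (h : (v, dv) ∈ H1 univ) : (star v, star dv) ∈ H1 univ := by
  obtain ⟨w, hw, hp⟩ := exists_isPrimOn_of_isWeakDeriv isOpen_univ ordConnected_univ
    (mem_univ (0 : ℝ)) h
  refine isWeakDeriv_univ (fun a b _ => (hp a b).star) ?_ ?_
  · filter_upwards [hw, Lp.coeFn_star v] with x h1 h2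
    rw [h2, Pi.star_apply, h1, RCLike.star_def]
  · filter_upwards [Lp.coeFn_star dv] with x h2
    rw [h2, Pi.star_apply, RCLike.star_def, indicator_univ]

/-- The coefficient is real, so testing each equation with the conjugate of the other function gives
the same symmetric integral twice. -/
lemma pairing_opAeps {α β : ℝ} {p : ℝ → ℝ} {ε : ℝ} {u g v h : L2 univ}
    (hu : (u, g) ∈ opAeps α β p ε) (hv : (v, h) ∈ opAeps α β p ε) :
    pairing v g = pairing u h := by
  obtain ⟨du, hdu, h1⟩ := hu
  obtain ⟨dv, hdv, h2⟩ := hv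
  have e1 := h1 _ _ (star_mem_H1_univ hdv)
  have e2 := h2 _ _ (star_mem_H1_univ hdu)
  change _ = pairing v g at e1
  change _ = pairing u h at e2
  rw [← e1, ← e2]
  refine integral_congr_ae ?_
  filter_upwards [Lp.coeFn_star du, Lp.coeFn_star dv] with x h1 h2
  rw [h1, h2, Pi.star_apply, Pi.star_apply, RCLike.star_def, Complex.conj_conj, Complex.conj_conj]
  ring

/-! ### Scaling and the periodic coefficient. -/

lemma map_mul_left_volume {c : ℝ} (hc : c ≠ 0) :
    Measure.map (fun x : ℝ => c * x) volume = ENNReal.ofReal |c⁻¹| • volume :=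
  Real.map_volume_mul_left hc

lemma quasiMeasurePreserving_mul_left {c : ℝ} (hc : c ≠ 0) :
    Measure.QuasiMeasurePreserving (fun x : ℝ => c * x) := by
  refine ⟨measurable_const_mul c, ?_⟩
  rw [map_mul_left_volume hc]
  exact Measure.smul_absolutelyContinuous

lemma MeasureTheory.MemLp.comp_const_mul {F : ℝ → ℂ} (hF : MemLp F 2) {c : ℝ} (hc : c ≠ 0) :
    MemLp (fun x => F (c * x)) 2 := by
  have h1 : MemLp F 2 (Measure.map (fun x : ℝ => c * x) volume) := by
    rw [map_mul_left_volume hc]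
    exact hF.smul_measure ENNReal.ofReal_ne_top
  exact (memLp_map_measure_iff h1.1 (measurable_const_mul c).aemeasurable).1 h1

lemma IsPrimOn.comp_div {u g : ℝ → ℂ} {c : ℝ} (hc : 0 < c) {a b : ℝ}
    (h : IsPrimOn u g (a / c) (b / c)) :
    IsPrimOn (fun x => u (x / c)) (fun x => (c : ℂ)⁻¹ * g (x / c)) a b := by
  refine ⟨?_, fun x hx => ?_⟩
  · have := (h.integrable.comp_mul_left (c := c⁻¹)).const_mul (c : ℂ)⁻¹
    have e : ∀ y : ℝ, y / c / c⁻¹ = y := fun y => by field_simp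
    rw [e, e] at this
    simpa only [inv_mul_eq_div] using this
  · rw [intervalIntegral.integral_const_mul,
      intervalIntegral.integral_comp_div (fun t => g t) hc.ne', Complex.real_smul, ← mul_assoc,
      inv_mul_cancel₀ (Complex.ofReal_ne_zero.2 hc.ne'), one_mul]
    exact h.eq _ ⟨by have := hx.1; gcongr, by have := hx.2; gcongr⟩

/-- Transfers measurability and almost-everywhere bounds of the coefficient from the cell to the
line. -/
lemma quasiMeasurePreserving_fract :
    Measure.QuasiMeasurePreserving (Int.fract : ℝ → ℝ) volume (volume.restrict (Ioo 0 1)) := by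
  refine ⟨measurable_fract, Measure.AbsolutelyContinuous.mk fun s hs h0 => ?_⟩
  rw [Measure.map_apply measurable_fract hs]
  rw [Measure.restrict_apply hs] at h0
  have hsub : (Int.fract : ℝ → ℝ) ⁻¹' s ⊆
      (⋃ n : ℤ, (fun y : ℝ => y + n) '' (s ∩ Ioo 0 1)) ∪ range ((↑) : ℤ → ℝ) := by
    intro y hy
    rcases eq_or_ne (Int.fract y) 0 with h | h
    · exact Or.inr ⟨⌊y⌋, by rw [← Int.self_sub_fract, h, sub_zero]⟩
    · refine Or.inl (mem_iUnion.2 ⟨⌊y⌋, Int.fract y, ⟨hy, ?_, Int.fract_lt_one y⟩,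
        Int.fract_add_floor y⟩)
      exact lt_of_le_of_ne (Int.fract_nonneg y) h.symm
  refine measure_mono_null hsub (measure_union_null (measure_iUnion_null fun n => ?_)
    ((countable_range _).measure_zero volume))
  rw [image_add_right, measure_preimage_add_right]
  exact h0

lemma measurable_chiPer {S : Set ℝ} (hS : MeasurableSet S) : Measurable (chiPer S) :=
  (measurable_one.indicator hS).comp measurable_fract

lemma chiPer_eq_one {S : Set ℝ} {y : ℝ} (h : Int.fract y ∈ S) : chiPer S y = 1 := by
  simp [chiPer, h]

lemma chiPer_eq_zero {S : Set ℝ} {y : ℝ} (h : Int.fract y ∉ S) : chiPer S y = 0 := by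
  simp [chiPer, h]

lemma measurableSet_cellQ0 (α β : ℝ) : MeasurableSet (cellQ0 α β) := measurableSet_Ioo

lemma measurableSet_cellQ1 (α β : ℝ) : MeasurableSet (cellQ1 α β) := isOpen_interior.measurableSet

lemma notMem_cellQ1_of_mem_cellQ0 {α β y : ℝ} (h : y ∈ cellQ0 α β) : y ∉ cellQ1 α β :=
  fun h1 => (interior_subset h1).2 h

/-- Up to a null set, the cell is the disjoint union of its two components. -/
lemma ae_mem_cellQ0_or_cellQ1 (α β : ℝ) :
    ∀ᵐ y ∂(volume.restrict (Ioo (0 : ℝ) 1)), y ∈ cellQ0 α β ∨ y ∈ cellQ1 α β := by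
  have h1 : ∀ᵐ y : ℝ, y ≠ α ∧ y ≠ β := by
    filter_upwards [compl_mem_ae_iff.2 (measure_singleton α),
      compl_mem_ae_iff.2 (measure_singleton β)] with x h1 h2
    exact ⟨h1, h2⟩
  filter_upwards [ae_restrict_of_ae h1, ae_restrict_mem measurableSet_Ioo] with y hy hy1
  by_cases h : y ∈ cellQ0 α β
  · exact Or.inl h
  · refine Or.inr (mem_interior_iff_mem_nhds.2 ?_)
    have h2 : y ∉ Icc α β := fun h3 =>
      h ⟨lt_of_le_of_ne h3.1 hy.1.symm, lt_of_le_of_ne h3.2 hy.2⟩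
    filter_upwards [Ioo_mem_nhds hy1.1 hy1.2, isClosed_Icc.isOpen_compl.mem_nhds h2] with x h3 h4
    exact ⟨h3, fun h5 => h4 (Ioo_subset_Icc_self h5)⟩

/-- The coefficient `(χ₀ + δ χ₁) / p` of the system that is equivalent to the equation. -/
noncomputable def sysCoeff (α β : ℝ) (p : ℝ → ℝ) (δ y : ℝ) : ℂ :=
  (((p y)⁻¹ * (chiPer (cellQ0 α β) y + δ * chiPer (cellQ1 α β) y) : ℝ) : ℂ)

lemma periodic_sysCoeff (α β : ℝ) {p : ℝ → ℝ} (hper : Function.Periodic p 1) (δ : ℝ) :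
    Function.Periodic (sysCoeff α β p δ) 1 := by
  intro y
  simp only [sysCoeff, chiPer, hper y, Int.fract_add_one]

lemma apply_fract_of_periodic {X : Type*} {f : ℝ → X} (hf : Function.Periodic f 1) (y : ℝ) :
    f (Int.fract y) = f y := by
  have := hf.sub_zsmul_eq (x := y) ⌊y⌋
  rwa [zsmul_one] at this

lemma abs_chiPer_add_le (α β : ℝ) {δ : ℝ} (hδ : 0 ≤ δ) (y : ℝ) :
    |chiPer (cellQ0 α β) y + δ * chiPer (cellQ1 α β) y| ≤ 1 + δ := by
  by_cases h0 : Int.fract y ∈ cellQ0 α β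
  · rw [chiPer_eq_one h0, chiPer_eq_zero (notMem_cellQ1_of_mem_cellQ0 h0)]
    simp [hδ]
  · rw [chiPer_eq_zero h0]
    by_cases h1 : Int.fract y ∈ cellQ1 α β
    · rw [chiPer_eq_one h1]
      simp [abs_of_nonneg hδ]
    · rw [chiPer_eq_zero h1]
      simp
      linarith

lemma abs_chiPer_le_one (S : Set ℝ) (y : ℝ) : |chiPer S y| ≤ 1 := by
  by_cases h : Int.fract y ∈ S
  · simp [chiPer_eq_one h]
  · simp [chiPer_eq_zero h]

lemma exists_ae_bound {q : ℝ → ℝ} (hq : MemLp q ∞ (volume.restrict (Ioo 0 1))) :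
    ∃ N : ℝ, 0 ≤ N ∧ ∀ᵐ y ∂(volume.restrict (Ioo (0 : ℝ) 1)), |q y| ≤ N := by
  refine ⟨(eLpNorm q ∞ (volume.restrict (Ioo 0 1))).toReal, ENNReal.toReal_nonneg, ?_⟩
  have h := ae_le_eLpNormEssSup (f := q) (μ := volume.restrict (Ioo 0 1))
  filter_upwards [h] with y hy
  rw [← eLpNorm_exponent_top] at hy
  have := ENNReal.toReal_mono hq.2.ne hy
  simpa using this

section

variable {α β : ℝ} {p : ℝ → ℝ} {N : ℝ}

lemma aestronglyMeasurable_sysCoeff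
    (hpm : AEStronglyMeasurable (fun y => (p y)⁻¹) (volume.restrict (Ioo 0 1))) (δ : ℝ) :
    AEStronglyMeasurable (sysCoeff α β p δ) (volume.restrict (Ioo 0 1)) :=
  Complex.continuous_ofReal.comp_aestronglyMeasurable (hpm.mul
    ((measurable_chiPer (measurableSet_cellQ0 α β)).add
      ((measurable_chiPer (measurableSet_cellQ1 α β)).const_mul δ)).aestronglyMeasurable)

lemma isBddCoeff_sysCoeff
    (hpm : AEStronglyMeasurable (fun y => (p y)⁻¹) (volume.restrict (Ioo 0 1))) (hN0 : 0 ≤ N)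
    (hN : ∀ᵐ y ∂(volume.restrict (Ioo (0 : ℝ) 1)), |(p y)⁻¹| ≤ N) {δ : ℝ} (hδ : 0 ≤ δ) :
    IsBddCoeff (sysCoeff α β p δ) (N * (1 + δ)) := by
  refine ⟨by positivity, aestronglyMeasurable_sysCoeff hpm δ, ?_⟩
  filter_upwards [hN] with y hy
  rw [sysCoeff, Complex.norm_real, Real.norm_eq_abs, abs_mul]
  gcongr
  exact abs_chiPer_add_le α β hδ y

/-- Only the term δ χ₁ / p remains, so with δ = ε² the coefficients converge uniformly at rate ε².
-/
lemma isBddCoeff_sysCoeff_sub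
    (hpm : AEStronglyMeasurable (fun y => (p y)⁻¹) (volume.restrict (Ioo 0 1))) (hN0 : 0 ≤ N)
    (hN : ∀ᵐ y ∂(volume.restrict (Ioo (0 : ℝ) 1)), |(p y)⁻¹| ≤ N) {δ : ℝ} (hδ : 0 ≤ δ) :
    IsBddCoeff (fun y => sysCoeff α β p δ y - sysCoeff α β p 0 y) (N * δ) := by
  refine ⟨by positivity, (aestronglyMeasurable_sysCoeff hpm δ).sub
    (aestronglyMeasurable_sysCoeff hpm 0), ?_⟩
  filter_upwards [hN] with y hy
  have e : sysCoeff α β p δ y - sysCoeff α β p 0 y =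
      (((p y)⁻¹ * (δ * chiPer (cellQ1 α β) y) : ℝ) : ℂ) := by
    simp only [sysCoeff]
    push_cast
    ring
  rw [e, Complex.norm_real, Real.norm_eq_abs, abs_mul, abs_mul, abs_of_nonneg hδ]
  have := abs_chiPer_le_one (cellQ1 α β) y
  calc |(p y)⁻¹| * (δ * |chiPer (cellQ1 α β) y|) ≤ N * (δ * 1) := by gcongr
    _ = N * δ := by ring

/-! ### The spectrum of A^ε and the unit circle. -/

/-- If the monodromy operator has no eigenvalue on the unit circle, `A^ε - z` is onto. -/
theorem exists_mem_opAeps (hper : Function.Periodic p 1) (hpos : ∀ y, 0 < p y) {ε : ℝ}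
    (hε : 0 < ε) {κ : ℝ} (hκ : 0 < κ) {K : ℝ} (h : IsBddCoeff (sysCoeff α β p (ε ^ 2)) K)
    {z : ℂ} (hK : K < κ) (hz : ‖z‖ < κ)
    (hL : ∀ μ : ℂ, ‖μ‖ = 1 → ∀ v, monodromy hκ h z v = μ • v → v = 0) (f : L2 univ) :
    ∃ u : L2 univ, (u, f + z • u) ∈ opAeps α β p ε := by
  have hε0 : (ε : ℂ) ≠ 0 := Complex.ofReal_ne_zero.2 hε.ne'
  have hper' := periodic_sysCoeff α β hper (ε ^ 2)
  have hfr : sysCoeff α β p (ε ^ 2) = sysCoeff α β p (ε ^ 2) ∘ Int.fract :=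
    funext fun y => (apply_fract_of_periodic hper' y).symm
  have hbm : AEStronglyMeasurable (sysCoeff α β p (ε ^ 2)) := by
    rw [hfr]
    exact h.meas.comp_quasiMeasurePreserving quasiMeasurePreserving_fract
  have hbK : ∀ᵐ t, ‖sysCoeff α β p (ε ^ 2) t‖ ≤ K := by
    filter_upwards [quasiMeasurePreserving_fract.ae h.bound] with t ht
    rwa [apply_fract_of_periodic hper'] at ht
  have hf : MemLp f 2 := by simpa using Lp.memLp f
  obtain ⟨U, W, hU, hW, pU, pW⟩ := exists_line_solution hκ h hK hz hper' hbm hbK hL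
    (hf.comp_const_mul hε.ne')
  set b := sysCoeff α β p (ε ^ 2) with hb
  have hbW : MemLp (fun t => b t * W t) 2 := by
    refine hW.of_le_mul (c := K) (hbm.mul hW.1) ?_
    filter_upwards [hbK] with t ht
    rw [norm_mul]
    gcongr
  have hdiv : ∀ {g : ℝ → ℂ}, MemLp g 2 → MemLp (fun x => g (x / ε)) 2 := by
    intro g hg
    simpa only [inv_mul_eq_div] using hg.comp_const_mul (inv_ne_zero hε.ne')
  have hlift : ∀ {g : ℝ → ℂ}, MemLp g 2 → MemLp g 2 (volume.restrict univ) := by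
    intro g hg
    rwa [Measure.restrict_univ]
  have hu := hdiv hU
  have hdu := (hdiv hbW).const_mul (ε : ℂ)⁻¹
  have pu : ∀ x y, IsPrimOn (fun x => U (x / ε)) (fun x => (ε : ℂ)⁻¹ * (b (x / ε) * W (x / ε))) x y :=
    fun x y => IsPrimOn.comp_div hε (pU (x / ε) (y / ε))
  -- The factor ε in the flux cancels the ε⁻¹ from differentiating in x, so the second equation of
  -- the system becomes the divergence equation.
  have pw : ∀ x y, IsPrimOn (fun x => ε * W (x / ε)) (fun x => -(z * U (x / ε) + f x)) x y := by
    intro x y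
    have := (IsPrimOn.comp_div hε (pW (x / ε) (y / ε))).const_mul (ε : ℂ)
    convert this using 2 with t
    rw [mul_inv_cancel_left₀ hε0, mul_div_cancel₀ _ hε.ne']
  set u : L2 univ := (hlift hu).toLp _ with hudef
  set du : L2 univ := (hlift hdu).toLp _ with hdudef
  refine ⟨u, du, isWeakDeriv_univ (fun x y _ => pu x y) (MemLp.coeFn_toLp (hlift hu))
    (MemLp.coeFn_toLp (hlift hdu)), fun v dv hv => ?_⟩
  obtain ⟨w, hw, pv⟩ := exists_isPrimOn_of_isWeakDeriv isOpen_univ ordConnected_univ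
    (mem_univ (0 : ℝ)) hv
  have hvL : MemLp w 2 := by
    have := (memLp_congr_ae hw).1 (Lp.memLp v)
    rwa [Measure.restrict_univ] at this
  have hdvL : MemLp dv 2 := by simpa using Lp.memLp dv
  have hparts := integral_mul_add_mul_eq_zero (fun x y _ => pw x y) (fun x y _ => (pv x y).star)
    ((hdiv hW).const_mul (ε : ℂ)) ((hu.const_mul z).add hf).neg hvL.star
    (by simp only [indicator_univ]; exact hdvL.star)
  have hi1 : Integrable (fun x => -(z * U (x / ε) + f x) * conj (w x)) :=
    ((hu.const_mul z).add hf).neg.integrable_mul hvL.star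
  have hi2 : Integrable (fun x => ε * W (x / ε) * conj (dv x)) :=
    ((hdiv hW).const_mul (ε : ℂ)).integrable_mul hdvL.star
  simp only [indicator_univ] at hparts
  rw [integral_add hi1 hi2] at hparts
  have hchi : ∀ᵐ x : ℝ, Int.fract (x / ε) ∈ cellQ0 α β ∨ Int.fract (x / ε) ∈ cellQ1 α β := by
    have h1 := quasiMeasurePreserving_fract.ae (ae_mem_cellQ0_or_cellQ1 α β)
    have h2 := (quasiMeasurePreserving_mul_left (inv_ne_zero hε.ne')).ae h1
    simpa only [inv_mul_eq_div] using h2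
  -- The coefficient times `du` is `ε * W (x / ε)` on both components: ε² · ε⁻¹ on the soft one, and
  -- 1 · ε⁻¹ε² on the stiff one.
  have e1 : ∫ x in univ, (coeffEps α β p ε x : ℂ) * du x * conj (dv x) =
      ∫ x, ε * W (x / ε) * conj (dv x) := by
    rw [← setIntegral_univ (f := fun x => ε * W (x / ε) * conj (dv x))]
    refine integral_congr_ae ?_
    filter_upwards [MemLp.coeFn_toLp (hlift hdu), ae_restrict_of_ae hchi] with x h1 h2
    rw [hdudef, h1]
    congr 1
    have hp : (p (x / ε) : ℂ) ≠ 0 := Complex.ofReal_ne_zero.2 (hpos _).ne'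
    simp only [hb, coeffEps, sysCoeff]
    rcases h2 with h2 | h2
    · rw [chiPer_eq_one h2, chiPer_eq_zero (notMem_cellQ1_of_mem_cellQ0 h2)]
      push_cast
      field_simp
      ring
    · rw [chiPer_eq_one h2, chiPer_eq_zero fun h3 => notMem_cellQ1_of_mem_cellQ0 h3 h2]
      push_cast
      field_simp
      ring
  have e2 : inner ℂ v (f + z • u) = -∫ x, -(z * U (x / ε) + f x) * conj (w x) := by
    rw [inner_eq_integral, ← integral_neg,
      ← setIntegral_univ (f := fun x => -(-(z * U (x / ε) + f x) * conj (w x)))]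
    refine integral_congr_ae ?_
    filter_upwards [MemLp.coeFn_toLp (hlift hu), Lp.coeFn_add f (z • u), Lp.coeFn_smul z u, hw]
      with x h1 h2 h3 h4
    rw [h2, Pi.add_apply, h3, Pi.smul_apply, hudef, h1, h4, smul_eq_mul]
    ring
  rw [e1, e2]
  linear_combination hparts

/-- The contrapositive of solvability. The eigenvector is normalised so that compactness can be used
in the limit. -/
theorem exists_eigenvector_of_mem_opSpectrum (hper : Function.Periodic p 1) (hpos : ∀ y, 0 < p y) {ε : ℝ}
    (hε : 0 < ε) {κ : ℝ} (hκ : 0 < κ) {K : ℝ} (h : IsBddCoeff (sysCoeff α β p (ε ^ 2)) K)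
    {z : ℂ} (hK : K < κ) (hz : ‖z‖ < κ) (hzs : z ∈ opSpectrum (opAeps α β p ε)) :
    ∃ (μ : ℂ) (v : ℂ × ℂ), ‖μ‖ = 1 ∧ ‖v‖ = 1 ∧ monodromy hκ h z v = μ • v := by
  by_contra hcon
  push Not at hcon
  refine notMem_opSpectrum_of_surjective (fun u g v h => pairing_opAeps)
    (exists_mem_opAeps hper hpos hε hκ h hK hz fun μ hμ v hv => ?_) hzs
  by_contra hv0
  refine hcon μ ((‖v‖⁻¹ : ℂ) • v) hμ ?_ ?_
  · rw [norm_smul, norm_inv, Complex.norm_real, norm_norm, inv_mul_cancel₀ (norm_ne_zero_iff.2 hv0)]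
  · rw [map_smul, hv, smul_comm]

end

/-! ### Quasiperiodic functions and the limit problem. -/

lemma memLp_cellQ_of_continuous {f : ℝ → ℂ} (hf : Continuous f) :
    MemLp f 2 (volume.restrict cellQ) := by
  obtain ⟨C, hC⟩ := isCompact_Icc.exists_bound_of_continuousOn (hf.continuousOn (s := Icc 0 1))
  exact MemLp.of_bound hf.aestronglyMeasurable C ((ae_restrict_iff' measurableSet_Ioo).2
    (Eventually.of_forall fun x hx => hC x (Ioo_subset_Icc_self hx)))

lemma exists_fract_exp_eq {μ : ℂ} (hμ : ‖μ‖ = 1) :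
    ∃ θ ∈ Ico (0 : ℝ) 1, Complex.exp (2 * Real.pi * Complex.I * θ) = μ := by
  refine ⟨Int.fract (μ.arg / (2 * Real.pi)), ⟨Int.fract_nonneg _, Int.fract_lt_one _⟩, ?_⟩
  have e : (2 * Real.pi * Complex.I * (Int.fract (μ.arg / (2 * Real.pi)) : ℝ) : ℂ) =
      μ.arg * Complex.I - (⌊μ.arg / (2 * Real.pi)⌋ : ℤ) * (2 * Real.pi * Complex.I) := by
    rw [Int.fract]
    push_cast
    have : (Real.pi : ℂ) ≠ 0 := Complex.ofReal_ne_zero.2 Real.pi_ne_zero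
    field_simp
  rw [e, Complex.exp_periodic.sub_int_mul_eq]
  have := Complex.norm_mul_exp_arg_mul_I μ
  rwa [hμ, Complex.ofReal_one, one_mul] at this

lemma continuous_quasiExp (θ : ℝ) :
    Continuous fun y : ℝ => Complex.exp (2 * Real.pi * Complex.I * θ * y) := by fun_prop

/-- The continuous representative of a function in `H¹_θ(Q)` is `θ`-quasiperiodic. -/
lemma exists_isPrimOn_of_mem_H1theta {θ : ℝ} {φ dφ : L2 cellQ} (h : (φ, dφ) ∈ H1theta θ) :
    ∃ ψ : ℝ → ℂ, (∀ᵐ y ∂(volume.restrict cellQ), φ y = ψ y) ∧ IsPrimOn ψ dφ 0 1 ∧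
      ψ 1 = Complex.exp (2 * Real.pi * Complex.I * θ) * ψ 0 := by
  obtain ⟨h1, w, ⟨_, c, hc, hc01, hwc⟩, hw⟩ := h
  obtain ⟨ψ, hψ, hp⟩ := exists_isPrimOn_of_isWeakDeriv isOpen_Ioo ordConnected_Ioo
    (x₀ := 1 / 2) ⟨by norm_num, by norm_num⟩ h1
  have hp1 : IsPrimOn ψ dφ 0 1 := (hp 0 1).congr_deriv zero_le_one
    ((ae_restrict_iff' measurableSet_Ioo).2 (Eventually.of_forall fun t ht => indicator_of_mem ht _))
  refine ⟨ψ, hψ, hp1, ?_⟩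
  have hae : ψ =ᵐ[volume.restrict (Icc 0 1)]
      fun y => Complex.exp (2 * Real.pi * Complex.I * θ * y) * c y := by
    rw [← Measure.restrict_congr_set Ioo_ae_eq_Icc]
    filter_upwards [hψ, hw, hwc] with y e1 e2 e3
    rw [← e1, e2, e3]
  -- Continuous functions that agree almost everywhere on [0, 1] also agree at the end points, where
  -- periodicity of `c` can be used.
  have heq := Measure.eqOn_Icc_of_ae_eq volume zero_ne_one hae (hp1.continuousOn zero_le_one)
    ((continuous_quasiExp θ).continuousOn.mul hc)
  have e0 := heq (left_mem_Icc.2 zero_le_one)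
  have e1 := heq (right_mem_Icc.2 zero_le_one)
  simp only [Complex.ofReal_zero, Complex.ofReal_one, mul_zero, mul_one, Complex.exp_zero,
    one_mul] at e0 e1
  rw [e0, e1, hc01]

lemma mem_H1theta_of_isPrimOn {θ : ℝ} {u du : L2 cellQ} {v : ℝ → ℂ} (hv : Continuous v)
    (hp : IsPrimOn v du 0 1) (hu : ∀ᵐ y ∂(volume.restrict cellQ), u y = v y)
    (hθ : v 1 = Complex.exp (2 * Real.pi * Complex.I * θ) * v 0) : (u, du) ∈ H1theta θ := by
  refine ⟨isWeakDeriv_cellQ hp hu (Eventually.of_forall fun _ => rfl), ?_⟩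
  -- Multiplication by e^{ay} removes the quasiperiodic phase from `v`; the product is the periodic
  -- factor that is required.
  set a : ℂ := -(2 * Real.pi * Complex.I * θ) with ha
  set e : ℝ → ℂ := fun y => Complex.exp (a * y) with he
  have hec : Continuous e := by fun_prop
  have hed : ∀ y : ℝ, HasDerivAt e (a * e y) y := by
    intro y
    have := ((((hasDerivAt_id (y : ℂ)).const_mul a).cexp).comp_ofReal)
    simpa [he, mul_comm] using this
  have hpe : IsPrimOn e (fun y => a * e y) 0 1 :=
    IsPrimOn.of_hasDerivAt hed (continuous_const.mul hec)
  have hmul := hpe.mul hp zero_le_one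
  have m1 : MemLp (fun y => e y * v y) 2 (volume.restrict cellQ) :=
    memLp_cellQ_of_continuous (hec.mul hv)
  obtain ⟨C, hC⟩ := isCompact_Icc.exists_bound_of_continuousOn (hec.continuousOn (s := Icc 0 1))
  have m3 : MemLp (fun y => e y * du y) 2 (volume.restrict cellQ) :=
    (Lp.memLp du).of_le_mul (c := C) (hec.aestronglyMeasurable.mul (Lp.memLp du).1)
      ((ae_restrict_iff' measurableSet_Ioo).2 (Eventually.of_forall fun x hx => by
        rw [norm_mul]
        gcongr
        exact hC x (Ioo_subset_Icc_self hx)))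
  have m2 : MemLp (fun y => a * e y * v y + e y * du y) 2 (volume.restrict cellQ) :=
    (memLp_cellQ_of_continuous ((continuous_const.mul hec).mul hv)).add m3
  refine ⟨(m1.toLp _, m2.toLp _), ⟨isWeakDeriv_cellQ hmul m1.coeFn_toLp m2.coeFn_toLp,
    fun y => e y * v y, (hec.mul hv).continuousOn, ?_, m1.coeFn_toLp⟩, ?_⟩
  · simp only [he, hθ, ← mul_assoc, ← Complex.exp_add]
    simp [ha]
  · filter_upwards [hu, m1.coeFn_toLp] with y h1 h2
    rw [h1, h2, ← mul_assoc, he, ← Complex.exp_add]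
    simp [ha]

section

variable {α β : ℝ} {p : ℝ → ℝ}

lemma chiPer_of_mem_cellQ {S : Set ℝ} {y : ℝ} (hy : y ∈ cellQ) : chiPer S y = S.indicator 1 y := by
  rw [chiPer, Int.fract_eq_self.2 ⟨hy.1.le, hy.2⟩]

lemma sysCoeff_zero_of_mem_cellQ0 {y : ℝ} (hy : y ∈ cellQ) (h : y ∈ cellQ0 α β) :
    sysCoeff α β p 0 y = (p y : ℂ)⁻¹ := by
  simp [sysCoeff, chiPer_of_mem_cellQ hy, h]

lemma sysCoeff_zero_of_notMem_cellQ0 {y : ℝ} (hy : y ∈ cellQ) (h : y ∉ cellQ0 α β) :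
    sysCoeff α β p 0 y = 0 := by
  simp [sysCoeff, chiPer_of_mem_cellQ hy, h]

lemma cellQ0_subset (hα : 0 ≤ α) (hβ : β ≤ 1) : cellQ0 α β ⊆ cellQ := Ioo_subset_Ioo hα hβ

lemma notMem_cellQ0_of_mem_cellQ1 {y : ℝ} (h : y ∈ cellQ1 α β) : y ∉ cellQ0 α β :=
  fun h1 => notMem_cellQ1_of_mem_cellQ0 h1 h

/-- A quasiperiodic solution of the limit system is in `V(θ)` and is an eigenfunction. -/
lemma weak_equation_of_system (hα : 0 ≤ α) (hβ : β ≤ 1) (hpos : ∀ y, 0 < p y) {lam : ℂ} {θ : ℝ}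
    {u w : ℝ → ℂ} (hw : Continuous w)
    (pw : IsPrimOn w (fun t => -(lam * u t)) 0 1)
    (hw1 : w 1 = Complex.exp (2 * Real.pi * Complex.I * θ) * w 0) {U dU : L2 cellQ}
    (hU : ∀ᵐ y ∂(volume.restrict cellQ), U y = u y)
    (hdU : ∀ᵐ y ∂(volume.restrict cellQ), dU y = sysCoeff α β p 0 y * w y) {φ dφ : L2 cellQ}
    (hφ : (φ, dφ) ∈ Vtheta α β p θ) :
    ∫ y in cellQ0 α β, (p y : ℂ) * dU y * conj (dφ y) =
      lam * ∫ y in cellQ, U y * conj (φ y) := by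
  obtain ⟨ψ, hψ, pψ, hψ1⟩ := exists_isPrimOn_of_mem_H1theta hφ.1
  -- The flux `w` equals `p dU` only on Q₀ and need not vanish on Q₁; the integral extends to the
  -- cell because `dφ` vanishes on Q₁.
  have e1 : ∫ y in cellQ0 α β, (p y : ℂ) * dU y * conj (dφ y) =
      ∫ y in cellQ, w y * conj (dφ y) := by
    have hs : (volume.restrict cellQ).restrict (cellQ0 α β) = volume.restrict (cellQ0 α β) :=
      Measure.restrict_restrict_of_subset (cellQ0_subset hα hβ)
    rw [← hs, ← integral_indicator (measurableSet_cellQ0 α β)]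
    refine integral_congr_ae ?_
    have hq1 : ∀ᵐ y ∂(volume.restrict cellQ), y ∈ cellQ1 α β → (p y : ℂ) * dφ y = 0 := by
      rw [← ae_restrict_iff' (measurableSet_cellQ1 α β),
        Measure.restrict_restrict_of_subset (cellQ1_subset α β)]
      exact hφ.2
    filter_upwards [hdU, hq1, ae_mem_cellQ0_or_cellQ1 α β, ae_restrict_mem measurableSet_Ioo]
      with y h1 h2 h3 hy
    have hp : (p y : ℂ) ≠ 0 := Complex.ofReal_ne_zero.2 (hpos y).ne'
    rcases h3 with h3 | h3
    · rw [indicator_of_mem h3, h1, sysCoeff_zero_of_mem_cellQ0 hy h3, mul_inv_cancel_left₀ hp]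
    · rw [indicator_of_notMem (notMem_cellQ0_of_mem_cellQ1 h3),
        (mul_eq_zero.1 (h2 h3)).resolve_left hp, map_zero, mul_zero]
  have hprod := pw.mul pψ.star zero_le_one
  have hends := hprod.sub_eq (left_mem_Icc.2 zero_le_one) (right_mem_Icc.2 zero_le_one)
  have hunit : Complex.exp (2 * Real.pi * Complex.I * θ) *
      conj (Complex.exp (2 * Real.pi * Complex.I * θ)) = 1 := by
    rw [← Complex.exp_conj, ← Complex.exp_add]
    simp [map_ofNat (starRingEnd ℂ)]
  -- The flux and the test function carry the same phase of modulus one, so the boundary terms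
  -- cancel.
  have hzero : w 1 * conj (ψ 1) - w 0 * conj (ψ 0) = 0 := by
    rw [hw1, hψ1, map_mul]
    linear_combination (w 0 * conj (ψ 0)) * hunit
  have hi1 : IntervalIntegrable (fun y => -(lam * u y) * conj (ψ y)) volume 0 1 :=
    pw.integrable.mul_continuousOn (by
      rw [uIcc_of_le zero_le_one]
      exact (pψ.star).continuousOn zero_le_one)
  have hi2 : IntervalIntegrable (fun y => w y * conj (dφ y)) volume 0 1 :=
    pψ.star.integrable.continuousOn_mul hw.continuousOn
  rw [hzero, intervalIntegral.integral_add hi1 hi2, intervalIntegral.integral_of_le zero_le_one,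
    intervalIntegral.integral_of_le zero_le_one, integral_Ioc_eq_integral_Ioo,
    integral_Ioc_eq_integral_Ioo] at hends
  have e2 : ∫ y in Ioo (0 : ℝ) 1, -(lam * u y) * conj (ψ y) =
      -(lam * ∫ y in cellQ, U y * conj (φ y)) := by
    rw [← integral_const_mul, ← integral_neg]
    refine integral_congr_ae ?_
    filter_upwards [hU, hψ] with y h1 h2
    rw [h1, h2]
    ring
  rw [e2] at hends
  rw [e1]
  linear_combination -hends

/-- An eigenfunction of `A(θ)` yields a point of its spectrum. -/
lemma mem_opSpectrum_of_weak_equation {lam : ℂ} {θ : ℝ} {u du : L2 cellQ}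
    (hu : (u, du) ∈ Vtheta α β p θ) (hu0 : u ≠ 0)
    (h : ∀ φ dφ : L2 cellQ, (φ, dφ) ∈ Vtheta α β p θ →
      ∫ y in cellQ0 α β, (p y : ℂ) * du y * conj (dφ y) =
        lam * ∫ y in cellQ, u y * conj (φ y)) :
    lam ∈ opSpectrum (opAtheta α β p θ) := by
  rintro ⟨R, -, hR⟩
  have hmem : u ∈ Htheta α β p θ :=
    Submodule.le_topologicalClosure _ (Submodule.mem_map_of_mem (f := LinearMap.fst ℂ _ _) hu)
  have hgraph : ((⟨u, hmem⟩ : Htheta α β p θ), lam • (⟨u, hmem⟩ : Htheta α β p θ)) ∈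
      opAtheta α β p θ := by
    refine ⟨du, hu, fun φ dφ hφ => ?_⟩
    rw [h φ dφ hφ]
    change _ = inner ℂ φ (lam • u)
    rw [inner_smul_right, inner_eq_integral]
  have := hR _ _ hgraph
  rw [sub_self, map_zero] at this
  exact hu0 (congrArg Subtype.val this).symm

/-- If `u` vanishes, `w` is constant, and 0 = u(β) - u(α) is this constant times the positive
integral of p⁻¹ over Q₀. Thus a nonzero solution of the system cannot have a zero first component.
-/
lemma eq_zero_of_forall_eq_zero (hα : 0 ≤ α) (hαβ : α < β) (hβ : β ≤ 1) (hpos : ∀ y, 0 < p y)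
    (hpinv : MemLp (fun y => (p y)⁻¹) ∞ (volume.restrict (Ioo 0 1))) {lam : ℂ} {u w : ℝ → ℂ}
    (pu : IsPrimOn u (fun t => sysCoeff α β p 0 t * w t) 0 1)
    (pw : IsPrimOn w (fun t => -(lam * u t)) 0 1) (h : ∀ y ∈ Icc (0 : ℝ) 1, u y = 0) :
    w 0 = 0 := by
  have hwc : ∀ x ∈ Icc (0 : ℝ) 1, w x = w 0 := by
    intro x hx
    rw [pw.eq x hx, intervalIntegral.integral_congr (g := fun _ => 0), intervalIntegral.integral_zero,
      add_zero]
    intro t ht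
    rw [uIcc_of_le hx.1] at ht
    simp only [h t ⟨ht.1, ht.2.trans hx.2⟩, mul_zero, neg_zero]
  have hαI : α ∈ Icc (0 : ℝ) 1 := ⟨hα, hαβ.le.trans hβ⟩
  have hβI : β ∈ Icc (0 : ℝ) 1 := ⟨hα.trans hαβ.le, hβ⟩
  have e1 := pu.sub_eq hαI hβI
  have hi : IntervalIntegrable (fun y => (p y)⁻¹) volume α β := by
    rw [intervalIntegrable_iff_integrableOn_Ioo_of_le hαβ.le]
    have h1 : IntegrableOn (fun y => (p y)⁻¹) (Ioo 0 1) :=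
      hpinv.integrable (by simp)
    exact h1.mono_set (cellQ0_subset hα hβ)
  have e2 : ∫ t in α..β, sysCoeff α β p 0 t * w t = ((∫ t in α..β, (p t)⁻¹ : ℝ) : ℂ) * w 0 := by
    rw [← intervalIntegral.integral_ofReal, ← intervalIntegral.integral_mul_const,
      intervalIntegral.integral_of_le hαβ.le, intervalIntegral.integral_of_le hαβ.le,
      integral_Ioc_eq_integral_Ioo, integral_Ioc_eq_integral_Ioo]
    refine setIntegral_congr_fun measurableSet_Ioo fun t ht => ?_
    have ht1 := cellQ0_subset hα hβ ht
    simp only [sysCoeff_zero_of_mem_cellQ0 ht1 ht, hwc t (Ioo_subset_Icc_self ht1)]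
    push_cast
    rfl
  rw [e2, h _ hαI, h _ hβI, sub_zero] at e1
  have hpi : 0 < ∫ t in α..β, (p t)⁻¹ :=
    intervalIntegral.intervalIntegral_pos_of_pos hi (fun x => inv_pos.2 (hpos x)) hαβ
  exact (mul_eq_zero.1 e1.symm).resolve_left (Complex.ofReal_ne_zero.2 hpi.ne')

/-- An eigenvalue on the unit circle of the limit monodromy operator yields an eigenfunction. -/
theorem exists_eigenfunction (hα : 0 ≤ α) (hαβ : α < β) (hβ : β ≤ 1) (hpos : ∀ y, 0 < p y)
    (hpinv : MemLp (fun y => (p y)⁻¹) ∞ (volume.restrict (Ioo 0 1))) {κ : ℝ} (hκ : 0 < κ) {K : ℝ}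
    (h : IsBddCoeff (sysCoeff α β p 0) K) {lam : ℂ} (hK : K < κ) (hlam : ‖lam‖ < κ) {μ : ℂ}
    (hμ : ‖μ‖ = 1) {v : ℂ × ℂ} (hv0 : v ≠ 0) (hv : monodromy hκ h lam v = μ • v) :
    ∃ θ ∈ Ico (0 : ℝ) 1, ∃ u du : L2 cellQ, (u, du) ∈ Vtheta α β p θ ∧ u ≠ 0 ∧
      ∀ φ dφ : L2 cellQ, (φ, dφ) ∈ Vtheta α β p θ →
        ∫ y in cellQ0 α β, (p y : ℂ) * du y * conj (dφ y) =
          lam * ∫ y in cellQ, u y * conj (φ y) := by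
  obtain ⟨C, _, hsol⟩ := exists_cell_solution hκ h hK hlam
  obtain ⟨d, hd, hsol⟩ := hsol (fun _ => 0) intervalIntegrable_const
  obtain ⟨u, w, hu, hw, pu, pw, hu0, hw0, h1, -⟩ := hsol v
  -- Without forcing the correction at the end point vanishes, and the end values are given by the
  -- monodromy operator alone.
  have hd0 : d = 0 := by simpa using hd
  rw [hv, hd0, add_zero, Prod.ext_iff] at h1
  simp only [Prod.smul_fst, Prod.smul_snd, smul_eq_mul, ← hu0, ← hw0] at h1
  simp only [add_zero] at pw
  obtain ⟨θ, hθ, hexp⟩ := exists_fract_exp_eq hμ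
  rw [← hexp] at h1
  have mu := memLp_cellQ_of_continuous hu
  have mdu : MemLp (fun t => sysCoeff α β p 0 t * w t) 2 (volume.restrict cellQ) := by
    refine (memLp_cellQ_of_continuous hw).of_le_mul (c := K)
      (h.meas.mul hw.aestronglyMeasurable) ?_
    filter_upwards [h.bound] with t ht
    rw [norm_mul]
    gcongr
  have hU := mu.coeFn_toLp
  have hdU := mdu.coeFn_toLp
  have hp : IsPrimOn u (mdu.toLp _) 0 1 := pu.congr_deriv zero_le_one (by
    filter_upwards [hdU] with t ht using ht.symm)
  refine ⟨θ, hθ, mu.toLp _, mdu.toLp _, ⟨mem_H1theta_of_isPrimOn hu hp hU h1.1, ?_⟩, ?_,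
    fun φ dφ hφ => weak_equation_of_system hα hβ hpos hw pw h1.2 hU hdU hφ⟩
  · filter_upwards [ae_restrict_of_ae_restrict_of_subset (cellQ1_subset α β) hdU,
      ae_restrict_mem (measurableSet_cellQ1 α β)] with y h2 h3
    rw [h2, sysCoeff_zero_of_notMem_cellQ0 (cellQ1_subset α β h3) (notMem_cellQ0_of_mem_cellQ1 h3),
      zero_mul, mul_zero]
  · intro hzero
    have hae : u =ᵐ[volume.restrict (Icc 0 1)] fun _ => 0 := by
      rw [← Measure.restrict_congr_set Ioo_ae_eq_Icc]
      have h4 := Lp.coeFn_zero ℂ 2 (volume.restrict cellQ)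
      rw [hzero] at hU
      filter_upwards [hU, h4] with y h2 h3
      rw [← h2, h3, Pi.zero_apply]
    have hu00 := Measure.eqOn_Icc_of_ae_eq volume zero_ne_one hae hu.continuousOn continuousOn_const
    have hw00 := eq_zero_of_forall_eq_zero hα hαβ hβ hpos hpinv pu pw hu00
    exact hv0 (Prod.ext (by rw [← hu0]; exact hu00 (left_mem_Icc.2 zero_le_one))
      (by rw [← hw0]; exact hw00))

end

/-! ### The limit ε → 0. -/

/-- The set of operators with an eigenvalue on the unit circle is closed under limits. -/
lemma exists_eigenvector_of_tendsto {ι : Type*} {l : Filter ι} [l.NeBot]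
    {L : ι → ℂ × ℂ →L[ℂ] ℂ × ℂ} {L₀ : ℂ × ℂ →L[ℂ] ℂ × ℂ} (hL : Tendsto L l (𝓝 L₀))
    (h : ∀ᶠ i in l, ∃ (μ : ℂ) (v : ℂ × ℂ), ‖μ‖ = 1 ∧ ‖v‖ = 1 ∧ L i v = μ • v) :
    ∃ (μ : ℂ) (v : ℂ × ℂ), ‖μ‖ = 1 ∧ ‖v‖ = 1 ∧ L₀ v = μ • v := by
  have h' : ∀ᶠ i in l, ∃ q : ℂ × (ℂ × ℂ), ‖q.1‖ = 1 ∧ ‖q.2‖ = 1 ∧ L i q.2 = q.1 • q.2 := by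
    filter_upwards [h] with i ⟨μ, v, hi⟩
    exact ⟨(μ, v), hi⟩
  obtain ⟨q, hq⟩ := h'.choice
  -- An ultrafilter finer than `l` takes the place of a convergent subsequence, since `l` is
  -- arbitrary.
  set F := Ultrafilter.of l
  have hF : (F : Filter ι) ≤ l := Ultrafilter.of_le l
  have hqF := hF hq
  have hK : IsCompact (Metric.sphere (0 : ℂ) 1 ×ˢ Metric.sphere (0 : ℂ × ℂ) 1) :=
    (isCompact_sphere _ _).prod (isCompact_sphere _ _)
  obtain ⟨q₀, hq₀, hlim⟩ := hK.ultrafilter_le_nhds (F.map q) (by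
    rw [le_principal_iff]
    refine Ultrafilter.mem_map.2 ?_
    filter_upwards [hqF] with i hi
    exact ⟨by simpa using hi.1, by simpa using hi.2.1⟩)
  have hlim' : Tendsto q F (𝓝 q₀) := hlim
  have h1 : Tendsto (fun i => L i (q i).2) F (𝓝 (L₀ q₀.2)) :=
    ((continuous_fst.clm_apply continuous_snd).tendsto (L₀, q₀.2)).comp
      ((hL.mono_left hF).prodMk_nhds ((continuous_snd.tendsto _).comp hlim'))
  have h2 : Tendsto (fun i => (q i).1 • (q i).2) F (𝓝 (q₀.1 • q₀.2)) :=
    ((continuous_fst.tendsto _).comp hlim').smul ((continuous_snd.tendsto _).comp hlim')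
  refine ⟨q₀.1, q₀.2, by simpa using hq₀.1, by simpa using hq₀.2, tendsto_nhds_unique h1 ?_⟩
  refine h2.congr' ?_
  filter_upwards [hqF] with i hi using hi.2.2.symm

theorem theorem2p3 (α β : ℝ) (hα : 0 ≤ α) (hαβ : α < β) (hβ : β ≤ 1)
    (p : ℝ → ℝ) (hper : Function.Periodic p 1) (hpos : ∀ y, 0 < p y)
    (hp : MemLp p ∞ (volume.restrict (Ioo 0 1)))
    (hpinv : MemLp (fun y => (p y)⁻¹) ∞ (volume.restrict (Ioo 0 1)))
    {ι : Type*} (l : Filter ι) [l.NeBot] (ε : ι → ℝ) (hε : Tendsto ε l (𝓝[>] 0))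
    (lamε : ι → ℂ) (lam : ℂ)
    (hspec : ∀ᶠ i in l, lamε i ∈ opSpectrum (opAeps α β p (ε i)))
    (hlim : Tendsto lamε l (𝓝 lam)) :
    ∃ θ ∈ Ico (0 : ℝ) 1,
      (∃ u du : L2 cellQ, (u, du) ∈ Vtheta α β p θ ∧ u ≠ 0 ∧
        ∀ φ dφ : L2 cellQ, (φ, dφ) ∈ Vtheta α β p θ →
          ∫ y in cellQ0 α β, (p y : ℂ) * du y * conj (dφ y) =
            lam * ∫ y in cellQ, u y * conj (φ y)) ∧
      lam ∈ opSpectrum (opAtheta α β p θ) := by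
  obtain ⟨N, hN0, hN⟩ := exists_ae_bound hpinv
  -- One weight κ for the limit and for all small ε: it exceeds `‖lam‖`, hence eventually `‖lamε
  -- i‖`, and it exceeds `N * (1 + ε i ^ 2)` as soon as `N * ε i ^ 2 < 1 / 2`.
  have hκ : 0 < 2 * N + ‖lam‖ + 1 := by positivity
  have hb := fun i => isBddCoeff_sysCoeff (α := α) (β := β) hpinv.1 hN0 hN (sq_nonneg (ε i))
  have hb₀ := isBddCoeff_sysCoeff (α := α) (β := β) hpinv.1 hN0 hN le_rfl
  have hK₀ : N * (1 + 0) < 2 * N + ‖lam‖ + 1 := by linarith [norm_nonneg lam]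
  have hz₀ : ‖lam‖ < 2 * N + ‖lam‖ + 1 := by linarith
  have hε0 : Tendsto ε l (𝓝 0) := hε.mono_right nhdsWithin_le_nhds
  have hδ : Tendsto (fun i => N * ε i ^ 2) l (𝓝 0) := by
    simpa using (hε0.pow 2).const_mul N
  have hM := tendsto_monodromy hκ hb hb₀ hlim
    (fun i => isBddCoeff_sysCoeff_sub hpinv.1 hN0 hN (sq_nonneg (ε i))) hδ hK₀ hz₀
  have hev : ∀ᶠ i in l, ∃ (μ : ℂ) (v : ℂ × ℂ), ‖μ‖ = 1 ∧ ‖v‖ = 1 ∧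
      monodromy hκ (hb i) (lamε i) v = μ • v := by
    filter_upwards [hspec, hε self_mem_nhdsWithin, hδ.eventually (gt_mem_nhds one_half_pos),
      hlim.norm.eventually (gt_mem_nhds hz₀)] with i h1 h2 h3 h4
    exact exists_eigenvector_of_mem_opSpectrum hper hpos h2 hκ (hb i)
      (by linarith [norm_nonneg lam]) h4 h1
  obtain ⟨μ, v, hμ, hv1, hv⟩ := exists_eigenvector_of_tendsto hM hev
  obtain ⟨θ, hθ, u, du, hu, hu0, heq⟩ := exists_eigenfunction hα hαβ hβ hpos hpinv hκ hb₀ hK₀ hz₀ hμ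
    (norm_ne_zero_iff.1 (hv1 ▸ one_ne_zero)) hv
  exact ⟨θ, hθ, ⟨u, du, hu, hu0, heq⟩, mem_opSpectrum_of_weak_equation hu hu0 heq⟩
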